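/- **Proposition A.3 (comparison principle).** Let $p\ge 2$, $0<s<1$, let $\Omega\Subset\Omega'\subset\mathbb{R}^N$ with $\Omega,\Omega'$ open and $\Omega'$ bounded, and let $I=[t_0,t_1]$ with $t_0<t_1$. Put $J_p(\tau)=|\tau|^{p-2}\tau$ and $p'=p/(p-1)$. Let $W^{s,p}(\Omega')$ be the Sobolev–Slobodeckiĭ space with norm $$\|\psi\|_{W^{s,p}(\Omega')}=\|\psi\|_{L^p(\Omega')}+\Big(\iint_{\Omega'\times\Omega'}\frac{|\psi(x)-\psi(y)|^p}{|x-y|^{N+sp}}\,dx\,dy\Big)^{1/p},$$ let $L^{p-1}_{sp}(\mathbb{R}^N)$ be the tail space with norm $\big(\int_{\mathbb{R}^N}\frac{|\psi|^{p-1}}{1+|x|^{N+sp}}\,dx\big)^{1/(p-1)}$, and, for a function $\psi$, let $$X^{s,p}_\psi(\Omega,\Omega')=\{v\in W^{s,p}(\Omega')\cap L^{p-1}_{sp}(\mathbb{R}^N): v=\psi \text{ a.e. on }\mathbb{R}^N\setminus\Omega\},$$ where $X_0^{s,p}(\Omega,\Omega')$ (the case $\psi=0$) carries the norm of $W^{s,p}(\Omega')$.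 Let $u_0\in L^2(\Omega)$, and let $g$ satisfy $$g\in L^p(I;W^{s,p}(\Omega'))\cap L^{p-1}(I;L^{p-1}_{sp}(\mathbb{R}^N)),\qquad \partial_t g\in L^{p'}(I;(X^{s,p}_0(\Omega,\Omega'))^*),$$ $$\lim_{t\to t_0}\|g(\cdot,t)-g_0\|_{L^2(\Omega)}=0\quad\text{for some } g_0\in L^2(\Omega).$$ Let $u$ be a weak solution of $$\partial_t u+(-\Delta_p)^s u=0\ \text{ in }\Omega\times I,\qquad u=g\ \text{ on }(\mathbb{R}^N\setminus\Omega)\times I,\qquad u(\cdot,t_0)=u_0\ \text{ on }\Omega,$$ that is: $u\in L^p(I;W^{s,p}(\Omega'))\cap L^{p-1}(I;L^{p-1}_{sp}(\mathbb{R}^N))\cap C(I;L^2(\Omega))$; $u(\cdot,t)\in X^{s,p}_{g(\cdot,t)}(\Omega,\Omega')$ for a.e. $t\in I$; $\lim_{t\to t_0}\|u(\cdot,t)-u_0\|_{L^2(\Omega)}=0$; and for every $J=[T_0,T_1]\subset I$ and every $\phi\in L^p(J;X^{s,p}_0(\Omega,\Omega'))\cap C^1(J;L^2(\Omega))$, $$-\int_J\int_\Omega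 u\,\partial_t\phi\,dx\,dt+\int_J\iint_{\mathbb{R}^N\times\mathbb{R}^N}\frac{J_p(u(x,t)-u(y,t))\,(\phi(x,t)-\phi(y,t))}{|x-y|^{N+sp}}\,dx\,dy\,dt=\int_\Omega u(x,T_0)\,\phi(x,T_0)\,dx-\int_\Omega u(x,T_1)\,\phi(x,T_1)\,dx.$$ If $M\in\mathbb{R}$ is such that $u_0\le M$ a.e. in $\Omega$ and $g\le M$ a.e. in $\mathbb{R}^N\times I$, then $u\le M$ a.e. in $\mathbb{R}^N\times I$; moreover, for every $t\in I$, $u(\cdot,t)\le M$ a.e. in $\Omega$. -/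

import Mathlib

open MeasureTheory Set Filter Topology
open scoped ENNReal

noncomputable section

namespace FracParabolic

/-- The space `ℝ^N` with its Euclidean norm and Lebesgue measure. -/
abbrev Sp (N : ℕ) : Type := EuclideanSpace ℝ (Fin N)

variable {N : ℕ}

/-- The monotone function `J_β(t) = |t|^(β-2) t`. -/
def Jfun (β t : ℝ) : ℝ := |t| ^ (β - 2) * t

/-! ### Spaces of functions of the space variable -/

/-- The difference quotient `(ψ(x) - ψ(y)) / |x - y|^((N + β q) / q)`; the `q`-th power of its
absolute value is the integrand `|ψ(x) - ψ(y)|^q / |x - y|^(N + β q)` of the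
Sobolev-Slobodeckii seminorm. -/
def diffQuot (β q : ℝ) (ψ : Sp N → ℝ) (z : Sp N × Sp N) : ℝ :=
  (ψ z.1 - ψ z.2) / ‖z.1 - z.2‖ ^ (((N : ℝ) + β * q) / q)

/-- The seminorm `[ψ]_{W^{β,q}(A)}`, with values in `[0, ∞]`. -/
def gagliardoSeminorm (β q : ℝ) (A : Set (Sp N)) (ψ : Sp N → ℝ) : ℝ≥0∞ :=
  eLpNorm (diffQuot β q ψ) (ENNReal.ofReal q) ((volume.restrict A).prod (volume.restrict A))

/-- The norm `‖ψ‖_{L^q(A)} + [ψ]_{W^{β,q}(A)}` of `W^{β,q}(A)`, with values in `[0, ∞]`. -/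
def sobolevENorm (β q : ℝ) (A : Set (Sp N)) (ψ : Sp N → ℝ) : ℝ≥0∞ :=
  eLpNorm ψ (ENNReal.ofReal q) (volume.restrict A) + gagliardoSeminorm β q A ψ

/-- `ψ ∈ W^{β,q}(A)`: both `ψ ∈ L^q(A)` and `[ψ]_{W^{β,q}(A)} < ∞`. -/
def MemSobolev (β q : ℝ) (A : Set (Sp N)) (ψ : Sp N → ℝ) : Prop :=
  MemLp ψ (ENNReal.ofReal q) (volume.restrict A) ∧
    MemLp (diffQuot β q ψ) (ENNReal.ofReal q) ((volume.restrict A).prod (volume.restrict A))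

/-- The measure `dx / (1 + |x|^(N + α))` on `ℝ^N`. -/
def tailMeasure (N : ℕ) (α : ℝ) : Measure (Sp N) :=
  volume.withDensity fun x => ENNReal.ofReal (1 / (1 + ‖x‖ ^ ((N : ℝ) + α)))

/-- The norm `(∫ |ψ|^q / (1 + |x|^(N + α)) dx)^(1/q)` of the tail space `L^q_α(ℝ^N)`. -/
def tailENorm (q α : ℝ) (ψ : Sp N → ℝ) : ℝ≥0∞ :=
  eLpNorm ψ (ENNReal.ofReal q) (tailMeasure N α)

/-- `ψ ∈ L^q_α(ℝ^N)`. (Local `q`-integrability is automatic: the weight is bounded below by a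
positive constant on every bounded set.) -/
def MemTail (q α : ℝ) (ψ : Sp N → ℝ) : Prop :=
  MemLp ψ (ENNReal.ofReal q) (tailMeasure N α)

/-- `v ∈ X^{s,p}_ψ(Ω, Ω')`: `v ∈ W^{s,p}(Ω') ∩ L^{p-1}_{sp}(ℝ^N)` and `v = ψ` almost everywhere
on `ℝ^N \ Ω`. -/
def MemX (s p : ℝ) (Ω Ω' : Set (Sp N)) (ψ v : Sp N → ℝ) : Prop :=
  MemSobolev s p Ω' v ∧ MemTail (p - 1) (s * p) v ∧ v =ᵐ[volume.restrict Ωᶜ] ψ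

theorem diffQuot_add (β q : ℝ) (v w : Sp N → ℝ) :
    diffQuot β q (v + w) = diffQuot β q v + diffQuot β q w := by
  funext z
  simp only [diffQuot, Pi.add_apply]
  ring

theorem diffQuot_smul (β q c : ℝ) (v : Sp N → ℝ) :
    diffQuot β q (c • v) = c • diffQuot β q v := by
  funext z
  simp only [diffQuot, Pi.smul_apply, smul_eq_mul]
  ring

theorem diffQuot_zero (β q : ℝ) : diffQuot β q (0 : Sp N → ℝ) = 0 := by
  funext z
  simp [diffQuot]

/-- The vector space `X^{s,p}_0(Ω, Ω')`. -/
def X0Submodule (s p : ℝ) (Ω Ω' : Set (Sp N)) : Submodule ℝ (Sp N → ℝ) where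
  carrier := {v | MemX s p Ω Ω' 0 v}
  zero_mem' := by
    refine ⟨⟨MemLp.zero, ?_⟩, MemLp.zero, EventuallyEq.rfl⟩
    rw [diffQuot_zero]
    exact MemLp.zero
  add_mem' := by
    rintro v w ⟨⟨h1, h2⟩, h3, h4⟩ ⟨⟨k1, k2⟩, k3, k4⟩
    refine ⟨⟨h1.add k1, ?_⟩, MemLp.add h3 k3, ?_⟩
    · rw [diffQuot_add]
      exact h2.add k2
    · simpa using h4.add k4
  smul_mem' := by
    rintro c v ⟨⟨h1, h2⟩, h3, h4⟩
    refine ⟨⟨h1.const_smul c, ?_⟩, MemLp.const_smul h3 c, ?_⟩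
    · rw [diffQuot_smul]
      exact h2.const_smul c
    · simpa using h4.const_smul c

/-- `X^{s,p}_0(Ω, Ω')` as a type. It is to carry the norm of `W^{s,p}(Ω')`, for which `p ≥ 1` is
needed. Its elements are functions rather than classes of functions, so that the norm is a
seminorm; the topological dual is the same. -/
@[nolint unusedArguments]
def X0 (s p : ℝ) (_hp : 2 ≤ p) (Ω Ω' : Set (Sp N)) : Type := X0Submodule s p Ω Ω'

section X0

variable {s p : ℝ} {hp : 2 ≤ p} {Ω Ω' : Set (Sp N)}

instance : AddCommGroup (X0 s p hp Ω Ω') :=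
  inferInstanceAs (AddCommGroup (X0Submodule s p Ω Ω'))

instance : Module ℝ (X0 s p hp Ω Ω') :=
  inferInstanceAs (Module ℝ (X0Submodule s p Ω Ω'))

/-- The function `ℝ^N → ℝ` underlying an element of `X^{s,p}_0(Ω, Ω')`. -/
def X0.toFun (v : X0 s p hp Ω Ω') : Sp N → ℝ := v.1

instance : Norm (X0 s p hp Ω Ω') :=
  ⟨fun v => (sobolevENorm s p Ω' v.toFun).toReal⟩

theorem X0.sobolevENorm_ne_top (v : X0 s p hp Ω Ω') : sobolevENorm s p Ω' v.toFun ≠ ∞ :=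
  ENNReal.add_ne_top.2 ⟨v.2.1.1.2.ne, v.2.1.2.2.ne⟩

theorem X0.seminormedCore : SeminormedSpace.Core ℝ (X0 s p hp Ω Ω') where
  norm_nonneg _ := ENNReal.toReal_nonneg
  norm_smul c v := by
    change (sobolevENorm s p Ω' (c • v.toFun)).toReal
      = ‖c‖ * (sobolevENorm s p Ω' v.toFun).toReal
    have h : sobolevENorm s p Ω' (c • v.toFun) = ‖c‖ₑ * sobolevENorm s p Ω' v.toFun := by
      rw [sobolevENorm, sobolevENorm, gagliardoSeminorm, gagliardoSeminorm, diffQuot_smul,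
        eLpNorm_const_smul, eLpNorm_const_smul, mul_add]
    rw [h, ENNReal.toReal_mul, toReal_enorm]
  norm_triangle v w := by
    change (sobolevENorm s p Ω' (v.toFun + w.toFun)).toReal
      ≤ (sobolevENorm s p Ω' v.toFun).toReal + (sobolevENorm s p Ω' w.toFun).toReal
    rw [← ENNReal.toReal_add v.sobolevENorm_ne_top w.sobolevENorm_ne_top]
    refine ENNReal.toReal_mono
      (ENNReal.add_ne_top.2 ⟨v.sobolevENorm_ne_top, w.sobolevENorm_ne_top⟩) ?_
    have h1 : (1 : ℝ≥0∞) ≤ ENNReal.ofReal p := by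
      rw [← ENNReal.ofReal_one]
      exact ENNReal.ofReal_le_ofReal (by linarith)
    have e1 := eLpNorm_add_le v.2.1.1.1 w.2.1.1.1 h1
    have e2 := eLpNorm_add_le v.2.1.2.1 w.2.1.2.1 h1
    rw [← diffQuot_add] at e2
    calc sobolevENorm s p Ω' (v.toFun + w.toFun) ≤ _ := add_le_add e1 e2
      _ = _ := add_add_add_comm _ _ _ _

instance : SeminormedAddCommGroup (X0 s p hp Ω Ω') :=
  SeminormedAddCommGroup.ofCore X0.seminormedCore

instance : NormedSpace ℝ (X0 s p hp Ω Ω') :=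
  { (inferInstance : Module ℝ (X0 s p hp Ω Ω')) with
    norm_smul_le := fun c v => (X0.seminormedCore.norm_smul c v).le }

end X0

/-! ### Spaces of functions of time and space

A function `u` of `(x, t)` is written in the order `u t x`, so that `u t` is `u(·, t)`. Strong
measurability of `t ↦ u t` with values in one of the separable spaces above is expressed by joint
measurability of `u`. -/

/-- `u` is measurable on `ℝ^N × J`, up to a null set. -/
def JointlyMeasurable (J : Set ℝ) (u : ℝ → Sp N → ℝ) : Prop :=
  AEStronglyMeasurable (Function.uncurry u) ((volume.restrict J).prod (volume : Measure (Sp N)))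

/-- `u ∈ L^r(J; W^{β,q}(A))`. -/
def MemLpSobolev (r : ℝ) (J : Set ℝ) (β q : ℝ) (A : Set (Sp N)) (u : ℝ → Sp N → ℝ) : Prop :=
  JointlyMeasurable J u ∧ (∀ᵐ t ∂volume.restrict J, MemSobolev β q A (u t)) ∧
    ∫⁻ t in J, sobolevENorm β q A (u t) ^ r < ∞

/-- `u ∈ L^r(J; L^q_α(ℝ^N))`. -/
def MemLpTail (r : ℝ) (J : Set ℝ) (q α : ℝ) (u : ℝ → Sp N → ℝ) : Prop :=
  JointlyMeasurable J u ∧ (∀ᵐ t ∂volume.restrict J, MemTail q α (u t)) ∧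
    ∫⁻ t in J, tailENorm q α (u t) ^ r < ∞

/-- `U` is the map `t ↦ u(·, t)` from `J` to `L²(Ω)`. -/
def IsL2Curve (J : Set ℝ) (Ω : Set (Sp N)) (u : ℝ → Sp N → ℝ)
    (U : ℝ → Lp ℝ 2 (volume.restrict Ω)) : Prop :=
  ∀ t ∈ J, U t =ᵐ[volume.restrict Ω] u t

/-- `∂_t g ∈ L^{p'}(I; (X^{s,p}_0(Ω, Ω'))^*)` with `I = [t₀, t₁]` and `p' = p / (p - 1)`: the
distributional time derivative of `t ↦ g(·, t)`, which acts on `X^{s,p}_0(Ω, Ω')` by the scalar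
product of `L²(Ω)`, is represented by such a function. -/
def HasTimeDerivInDual (s p : ℝ) (hp : 2 ≤ p) (Ω Ω' : Set (Sp N)) (t₀ t₁ : ℝ)
    (g : ℝ → Sp N → ℝ) : Prop :=
  ∃ G : ℝ → StrongDual ℝ (X0 s p hp Ω Ω'),
    MemLp G (ENNReal.ofReal (p / (p - 1))) (volume.restrict (Icc t₀ t₁)) ∧
    ∀ (v : X0 s p hp Ω Ω') (η : ℝ → ℝ), ContDiff ℝ (⊤ : ℕ∞) η → HasCompactSupport η →
      tsupport η ⊆ Ioo t₀ t₁ →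
      ∫ t in Icc t₀ t₁, G t v * η t
        = -(∫ t in Icc t₀ t₁, (∫ x in Ω, g t x * v.toFun x) * deriv η t)

/-- The assumptions on the boundary datum `g`. -/
structure IsBoundaryDatum (s p : ℝ) (hp : 2 ≤ p) (Ω Ω' : Set (Sp N)) (t₀ t₁ : ℝ)
    (g : ℝ → Sp N → ℝ) : Prop where
  memSobolev : MemLpSobolev p (Icc t₀ t₁) s p Ω' g
  memTail : MemLpTail (p - 1) (Icc t₀ t₁) (p - 1) (s * p) g
  timeDeriv : HasTimeDerivInDual s p hp Ω Ω' t₀ t₁ g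
  /-- `g(·, t)` has a limit in `L²(Ω)` as `t → t₀`. As `g(·, t)` is only given for almost every
  `t`, a null set of times is disregarded. -/
  limit : ∃ g₀ : Sp N → ℝ, MemLp g₀ 2 (volume.restrict Ω) ∧
    Tendsto (fun t => eLpNorm (g t - g₀) 2 (volume.restrict Ω)) (𝓝[>] t₀ ⊓ ae volume) (𝓝 0)

/-- `φ ∈ L^p(J; X^{s,p}_0(Ω, Ω')) ∩ C¹(J; L²(Ω))` with `J = [T₀, T₁]`, where `Φ` is the map
`t ↦ φ(·, t)` from `J` to `L²(Ω)`; thus `∂_t φ(·, t)` is `derivWithin Φ (Icc T₀ T₁) t`. -/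
structure IsTestFunction (s p : ℝ) (Ω Ω' : Set (Sp N)) (T₀ T₁ : ℝ) (φ : ℝ → Sp N → ℝ)
    (Φ : ℝ → Lp ℝ 2 (volume.restrict Ω)) : Prop where
  memSobolev : MemLpSobolev p (Icc T₀ T₁) s p Ω' φ
  memX : ∀ᵐ t ∂volume.restrict (Icc T₀ T₁), MemX s p Ω Ω' 0 (φ t)
  curve : IsL2Curve (Icc T₀ T₁) Ω φ Φ
  contDiff : ContDiffOn ℝ 1 Φ (Icc T₀ T₁)

/-- `u` is a weak solution on `I = [t₀, t₁]` of the initial boundary value problem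
`∂_t u + (-Δ_p)^s u = 0` in `Ω × I`, `u = g` on `(ℝ^N \ Ω) × I`, `u(·, t₀) = u₀` on `Ω`. -/
structure IsWeakSolution (s p : ℝ) (Ω Ω' : Set (Sp N)) (t₀ t₁ : ℝ) (g : ℝ → Sp N → ℝ)
    (u₀ : Sp N → ℝ) (u : ℝ → Sp N → ℝ) : Prop where
  memSobolev : MemLpSobolev p (Icc t₀ t₁) s p Ω' u
  memTail : MemLpTail (p - 1) (Icc t₀ t₁) (p - 1) (s * p) u
  /-- `u ∈ C(I; L²(Ω))` -/
  continuous : ∃ U : ℝ → Lp ℝ 2 (volume.restrict Ω),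
    IsL2Curve (Icc t₀ t₁) Ω u U ∧ ContinuousOn U (Icc t₀ t₁)
  boundary : ∀ᵐ t ∂volume.restrict (Icc t₀ t₁), MemX s p Ω Ω' (g t) (u t)
  initial : Tendsto (fun t => eLpNorm (u t - u₀) 2 (volume.restrict Ω)) (𝓝[>] t₀) (𝓝 0)
  weak : ∀ T₀ T₁ : ℝ, t₀ ≤ T₀ → T₀ < T₁ → T₁ ≤ t₁ →
    ∀ (φ : ℝ → Sp N → ℝ) (Φ : ℝ → Lp ℝ 2 (volume.restrict Ω)),
    IsTestFunction s p Ω Ω' T₀ T₁ φ Φ →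
    -(∫ t in Icc T₀ T₁, ∫ x in Ω, u t x * derivWithin Φ (Icc T₀ T₁) t x)
      + (∫ t in Icc T₀ T₁, ∫ z : Sp N × Sp N,
          Jfun p (u t z.1 - u t z.2) * (φ t z.1 - φ t z.2) / ‖z.1 - z.2‖ ^ ((N : ℝ) + s * p))
      = (∫ x in Ω, u T₀ x * φ T₀ x) - ∫ x in Ω, u T₁ x * φ T₁ x

end FracParabolic

end

noncomputable section

namespace FracParabolic

variable {N : ℕ}

/-! Let `G = trunc M`, with convex primitive `Γ = truncPrim M`, and let `y(t) = ∫_Ω Γ(u(t))`. The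
theorem follows once `y` is nonincreasing: `y` is continuous and vanishes at `t₀` because `u₀ ≤ M`,
so `y ≤ 0`, and `Γ > 0` above `M` then forces `u ≤ M` in `Ω`. Outside `Ω` the bound is that of `g`.

The formal test function `G(u)` has no time derivative. It is therefore frozen: for almost every `τ`
the function `G(u(τ))`, constant in time, is an admissible test function on `[τ - σ, τ]`. Convexity
of `Γ` gives (`truncEnergy_sub_le`) that `y(τ) - y(τ - σ)` is at most minus the integral over `0 ≤ r
≤ σ` of the form evaluated at `u(τ - r)` and `G(u(τ))`. Integrating over `τ ∈ [a, T]` and exchanging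
integrals yields `∫_0^σ C(r) dr ≤ ∫_a^T (y(τ - σ) - y(τ)) dτ`, where `C(r)` is the time integral of
the form with delay `r`. After division by `σ → 0` the right side tends to `y(a) - y(T)` and the
left side to `C(0)`, which is nonnegative since `G` is monotone (`le_of_setIntegral_shift_le`).

What remains is continuity of `C` at `0`. On `Ω' × Ω'` the form pairs `L^{p'}` with `L^p`. For one
point in `Ω` and the other outside `Ω'`, it pairs an `L¹` flux, controlled by the tail norm, with a
bounded difference; this is why `G` is capped at `1`. Only the first factor is translated in time,
and translations are continuous in `L^q` for finite `q` (`tendsto_integral_timeShift_mul`). -/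

/-! ### A bounded truncation and its convex primitive -/

/-- The truncation `min ((r - M)₊, 1)`. -/
def trunc (M r : ℝ) : ℝ := min (max (r - M) 0) 1

/-- The primitive of `trunc M` that vanishes on `(-∞, M]`. -/
def truncPrim (M r : ℝ) : ℝ := trunc M r * max (r - M) 0 - trunc M r ^ 2 / 2

theorem trunc_nonneg (M r : ℝ) : 0 ≤ trunc M r := by
  unfold trunc; positivity

theorem trunc_le_one (M r : ℝ) : trunc M r ≤ 1 := min_le_right _ _

theorem abs_trunc_le_one (M r : ℝ) : |trunc M r| ≤ 1 := by
  rw [abs_of_nonneg (trunc_nonneg M r)]; exact trunc_le_one M r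

theorem trunc_mono (M : ℝ) : Monotone (trunc M) := fun a b h => by
  unfold trunc; gcongr

theorem continuous_trunc (M : ℝ) : Continuous (trunc M) := by
  unfold trunc; fun_prop

theorem continuous_truncPrim (M : ℝ) : Continuous (truncPrim M) := by
  have := continuous_trunc M
  unfold truncPrim; fun_prop

theorem trunc_eq_zero {M r : ℝ} (h : r ≤ M) : trunc M r = 0 := by
  unfold trunc
  rw [max_eq_right (by linarith)]; simp

theorem abs_trunc_sub_le (M a b : ℝ) : |trunc M a - trunc M b| ≤ |a - b| := by
  unfold trunc
  refine (abs_min_sub_min_le_max _ _ _ _).trans ?_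
  simp only [sub_self, abs_zero]
  refine max_le ((abs_max_sub_max_le_abs _ _ _).trans ?_) (abs_nonneg _)
  rw [sub_sub_sub_cancel_right]

theorem abs_trunc_sub_le_one (M a b : ℝ) : |trunc M a - trunc M b| ≤ 1 := by
  have := trunc_nonneg M a
  have := trunc_nonneg M b
  have := trunc_le_one M a
  have := trunc_le_one M b
  rw [abs_le]; constructor <;> linarith

/-- Convexity: the graph of the primitive lies above its tangent line at `b`, whose slope is `trunc
M b`. -/
theorem truncPrim_sub_le (M a b : ℝ) :
    truncPrim M b - truncPrim M a ≤ trunc M b * (b - a) := by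
  unfold truncPrim trunc
  rcases le_total (a - M) 0 with ha | ha <;> rcases le_total (b - M) 0 with hb | hb <;>
  simp only [ha, hb, max_eq_left, max_eq_right] <;>
  rcases le_total (a - M) 1 with ha' | ha' <;> rcases le_total (b - M) 1 with hb' | hb' <;>
  simp only [ha', hb', min_eq_left, min_eq_right, zero_le_one] <;>
  nlinarith [sq_nonneg (a - b)]

theorem abs_truncPrim_sub_le (M a b : ℝ) : |truncPrim M a - truncPrim M b| ≤ |a - b| := by
  have key : ∀ x y : ℝ, truncPrim M x - truncPrim M y ≤ |x - y| := fun x y =>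
    (truncPrim_sub_le M y x).trans <| (le_abs_self _).trans <| by
      rw [abs_mul]
      exact mul_le_of_le_one_left (abs_nonneg _) (abs_trunc_le_one M x)
  rw [abs_sub_le_iff]
  exact ⟨key a b, abs_sub_comm a b ▸ key b a⟩

theorem truncPrim_eq_zero {M r : ℝ} (h : r ≤ M) : truncPrim M r = 0 := by
  simp [truncPrim, trunc_eq_zero h]

theorem truncPrim_pos {M r : ℝ} (h : M < r) : 0 < truncPrim M r := by
  unfold truncPrim trunc
  rw [max_eq_left (by linarith)]
  rcases le_total (r - M) 1 with h' | h'
  · rw [min_eq_left h']; nlinarith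
  · rw [min_eq_right h']; linarith

theorem truncPrim_nonneg (M r : ℝ) : 0 ≤ truncPrim M r := by
  rcases le_or_gt r M with h | h
  · exact (truncPrim_eq_zero h).ge
  · exact (truncPrim_pos h).le

theorem abs_truncPrim_le (M r : ℝ) : |truncPrim M r| ≤ |r - M| := by
  have := abs_truncPrim_sub_le M r M
  rwa [truncPrim_eq_zero le_rfl, sub_zero] at this

/-! ### The function `J_p` -/

theorem measurable_Jfun (p : ℝ) : Measurable (Jfun p) := by
  unfold Jfun; fun_prop

theorem abs_Jfun {p : ℝ} (hp : 2 ≤ p) (t : ℝ) : |Jfun p t| = |t| ^ (p - 1) := by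
  unfold Jfun
  rw [abs_mul, abs_of_nonneg (by positivity)]
  rcases eq_or_ne t 0 with rfl | h
  · simp [Real.zero_rpow (by linarith : p - 1 ≠ 0)]
  · rw [show p - 1 = (p - 2) + 1 by ring, Real.rpow_add_one (abs_ne_zero.2 h)]

theorem abs_Jfun_sub_le {p : ℝ} (hp : 2 ≤ p) (a b : ℝ) :
    |Jfun p (a - b)| ≤ 2 ^ (p - 1) * (|a| ^ (p - 1) + |b| ^ (p - 1)) := by
  have h1 : 0 ≤ p - 1 := by linarith
  rw [abs_Jfun hp]
  rcases le_total |a| |b| with h | h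
  · calc |a - b| ^ (p - 1) ≤ (2 * |b|) ^ (p - 1) := by
          gcongr; exact (abs_sub a b).trans (by linarith)
      _ = 2 ^ (p - 1) * |b| ^ (p - 1) := Real.mul_rpow (by norm_num) (abs_nonneg _)
      _ ≤ _ := by gcongr; linarith [Real.rpow_nonneg (abs_nonneg a) (p - 1)]
  · calc |a - b| ^ (p - 1) ≤ (2 * |a|) ^ (p - 1) := by
          gcongr; exact (abs_sub a b).trans (by linarith)
      _ = 2 ^ (p - 1) * |a| ^ (p - 1) := Real.mul_rpow (by norm_num) (abs_nonneg _)
      _ ≤ _ := by gcongr; linarith [Real.rpow_nonneg (abs_nonneg b) (p - 1)]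

theorem Jfun_sub_mul_nonneg (p : ℝ) {G : ℝ → ℝ} (hG : Monotone G) (a b : ℝ) :
    0 ≤ Jfun p (a - b) * (G a - G b) := by
  unfold Jfun
  rw [mul_assoc]
  refine mul_nonneg (by positivity) ?_
  rcases le_total a b with h | h
  · exact mul_nonneg_of_nonpos_of_nonpos (by linarith) (by linarith [hG h])
  · exact mul_nonneg (by linarith) (by linarith [hG h])

/-- The kernel `r ^ α` is shared out: `p - 1` of its `p` equal factors go to `Jfun`, which is
homogeneous of degree `p - 1`, and one to the other difference. This prepares Hölder's inequality
with exponents `p'` and `p`. -/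
theorem Jfun_diffQuot_mul {p α : ℝ} (hp : 2 ≤ p) (hα : 0 < α) (d e : ℝ) {r : ℝ} (hr : 0 ≤ r) :
    Jfun p (d / r ^ (α / p)) * (e / r ^ (α / p)) = Jfun p d * e / r ^ α := by
  -- On the diagonal `r = 0` both sides vanish, since the powers are zero and division by zero gives
  -- zero.
  rcases hr.eq_or_lt with rfl | hr
  · rw [Real.zero_rpow hα.ne', Real.zero_rpow (by positivity)]; simp
  · have hc : 0 < r ^ (α / p) := by positivity
    have : r ^ α = (r ^ (α / p)) ^ (p - 2) * r ^ (α / p) * r ^ (α / p) := by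
      rw [← Real.rpow_mul hr.le, ← Real.rpow_add hr, ← Real.rpow_add hr]
      congr 1; field_simp; ring
    rw [this]
    unfold Jfun
    rw [abs_div, abs_of_pos hc, Real.div_rpow (abs_nonneg _) hc.le]
    field_simp

/-! ### Translations in time and pairings of functions of time and another variable -/

/-- Translation by `r` in the time variable. -/
def timeShift {Z : Type*} (r : ℝ) (z : ℝ × Z) : ℝ × Z := (z.1 - r, z.2)

/-- In this form the shift is part of the translation action on `Lp`, whose continuity gives
`tendsto_eLpNorm_timeShift_sub`. -/
theorem timeShift_eq_vadd {Z : Type*} [AddGroup Z] (r : ℝ) :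
    (timeShift r : ℝ × Z → ℝ × Z) = fun z => ((-r, 0) : ℝ × Z) +ᵥ z := by
  funext z
  simp [timeShift, Prod.ext_iff, sub_eq_neg_add]

theorem enorm_integral_mul_le {α : Type*} [MeasurableSpace α] {μ : Measure α} {q q' : ℝ≥0∞}
    [ENNReal.HolderConjugate q q'] {f k : α → ℝ} (hf : AEStronglyMeasurable f μ)
    (hk : AEStronglyMeasurable k μ) :
    ‖∫ z, f z * k z ∂μ‖ₑ ≤ eLpNorm f q μ * eLpNorm k q' μ := by
  refine (enorm_integral_le_lintegral_enorm _).trans ?_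
  have := eLpNorm_smul_le_mul_eLpNorm (p := q) (q := q') (r := 1) hk hf
  rwa [eLpNorm_one_eq_lintegral_enorm] at this

section Pairing

variable {Z : Type*} [NormedAddCommGroup Z] [SecondCountableTopology Z] [LocallyCompactSpace Z]
  [MeasureSpace Z] [BorelSpace Z] [(volume : Measure Z).IsAddHaarMeasure]

instance : (volume : Measure (ℝ × Z)).IsAddHaarMeasure :=
  inferInstanceAs ((volume : Measure ℝ).prod (volume : Measure Z)).IsAddHaarMeasure

theorem measurePreserving_timeShift (r : ℝ) :
    MeasurePreserving (timeShift r : ℝ × Z → ℝ × Z) volume volume := by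
  rw [timeShift_eq_vadd]
  exact measurePreserving_vadd _ _

theorem tendsto_eLpNorm_timeShift_sub {q : ℝ≥0∞} (hq : 1 ≤ q) (hq' : q ≠ ∞) {f : ℝ × Z → ℝ}
    (hf : MemLp f q volume) :
    Tendsto (fun r : ℝ => eLpNorm (f ∘ timeShift r - f) q volume) (𝓝 0) (𝓝 0) := by
  have : Fact (1 ≤ q) := ⟨hq⟩
  have : Fact (q ≠ ∞) := ⟨hq'⟩
  have h1 : Tendsto (fun r : ℝ => DomAddAct.mk ((-r, 0) : ℝ × Z) +ᵥ hf.toLp f) (𝓝 0)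
      (𝓝 (DomAddAct.mk ((-0, 0) : ℝ × Z) +ᵥ hf.toLp f)) := by
    refine Tendsto.vadd (Continuous.tendsto ?_ 0) tendsto_const_nhds
    exact DomAddAct.continuous_mk.comp (by fun_prop)
  have h0 : DomAddAct.mk ((-0, 0) : ℝ × Z) +ᵥ hf.toLp f = hf.toLp f := by
    rw [neg_zero, ← Prod.zero_eq_mk, DomAddAct.mk_zero, zero_vadd]
  rw [h0, tendsto_iff_edist_tendsto_0] at h1
  refine h1.congr fun r => ?_
  rw [DomAddAct.mk_vadd_toLp, Lp.edist_toLp_toLp, timeShift_eq_vadd]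
  rfl

theorem integrable_timeShift_mul {q q' : ℝ≥0∞} [ENNReal.HolderConjugate q q']
    {f k : ℝ × Z → ℝ} (hf : MemLp f q volume) (hk : MemLp k q' volume) (r : ℝ) :
    Integrable (fun z => f (timeShift r z) * k z) :=
  (hf.comp_measurePreserving (measurePreserving_timeShift r)).integrable_mul hk

/-- Hölder's inequality and continuity of translations. As `k` stays fixed, `q'` may be infinite;
the exponents used later are `(p', p)` and `(1, ∞)`. -/
theorem tendsto_integral_timeShift_mul {q q' : ℝ≥0∞} [ENNReal.HolderConjugate q q'] (hq : q ≠ ∞)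
    {f k : ℝ × Z → ℝ} (hf : MemLp f q volume) (hk : MemLp k q' volume) :
    Tendsto (fun r : ℝ => ∫ z, f (timeShift r z) * k z) (𝓝 0) (𝓝 (∫ z, f z * k z)) := by
  rw [tendsto_iff_edist_tendsto_0]
  have h1 := tendsto_eLpNorm_timeShift_sub (ENNReal.HolderConjugate.one_le q q') hq hf
  have h2 := ENNReal.Tendsto.mul_const h1 (b := eLpNorm k q' volume) (Or.inr hk.2.ne)
  rw [zero_mul] at h2
  refine tendsto_of_tendsto_of_tendsto_of_le_of_le tendsto_const_nhds h2 (fun _ => zero_le)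
    fun r => ?_
  have hs := hf.comp_measurePreserving (measurePreserving_timeShift (Z := Z) r)
  have e : (∫ z, f (timeShift r z) * k z) - ∫ z, f z * k z
      = ∫ z, (f ∘ timeShift r - f) z * k z := by
    rw [← integral_sub (integrable_timeShift_mul hf hk r)
      (hf.integrable_mul hk : Integrable fun z => f z * k z)]
    congr 1; funext z; simp [sub_mul]
  dsimp only
  rw [edist_eq_enorm_sub, e]
  exact enorm_integral_mul_le (hs.1.sub hf.1) hk.1

/-- Shifting preserves the `L^q` norm, so Hölder's bound is uniform in `r` and integrable over the
bounded interval. -/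
theorem integrable_timeShift_mul_prod {q q' : ℝ≥0∞} [ENNReal.HolderConjugate q q']
    {f k : ℝ × Z → ℝ} (hf : MemLp f q volume) (hk : MemLp k q' volume) (σ : ℝ) :
    Integrable (fun w : ℝ × (ℝ × Z) => f (timeShift w.1 w.2) * k w.2)
      ((volume.restrict (Icc 0 σ)).prod volume) := by
  have hqmp : Measure.QuasiMeasurePreserving
      (fun w : ℝ × (ℝ × Z) => timeShift w.1 w.2)
      ((volume.restrict (Icc 0 σ)).prod volume) volume := by
    refine ⟨by unfold timeShift; fun_prop, Measure.AbsolutelyContinuous.mk fun s hs h0 => ?_⟩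
    have hm : Measurable (fun w : ℝ × (ℝ × Z) => timeShift w.1 w.2) := by
      unfold timeShift; fun_prop
    rw [Measure.map_apply hm hs, Measure.measure_prod_null (hm hs)]
    refine Eventually.of_forall fun r => ?_
    exact (measurePreserving_timeShift r).quasiMeasurePreserving.preimage_null h0
  have hmeas : AEStronglyMeasurable (fun w : ℝ × (ℝ × Z) => f (timeShift w.1 w.2) * k w.2)
      ((volume.restrict (Icc 0 σ)).prod volume) :=
    (hf.1.comp_quasiMeasurePreserving hqmp).mul hk.1.comp_snd
  refine ⟨hmeas, ?_⟩
  rw [HasFiniteIntegral, lintegral_prod _ hmeas.enorm]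
  have hb : ∀ r : ℝ, ∫⁻ z, ‖f (timeShift r z) * k z‖ₑ
      ≤ eLpNorm f q volume * eLpNorm k q' volume := by
    intro r
    have hs := hf.comp_measurePreserving (measurePreserving_timeShift (Z := Z) r)
    have := eLpNorm_smul_le_mul_eLpNorm (p := q) (q := q') (r := 1) hk.1 hs.1
    rwa [eLpNorm_one_eq_lintegral_enorm,
      eLpNorm_comp_measurePreserving hf.1 (measurePreserving_timeShift r)] at this
  calc _ ≤ ∫⁻ r in Icc 0 σ, eLpNorm f q volume * eLpNorm k q' volume := lintegral_mono hb
    _ < ∞ := by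
      rw [setLIntegral_const]
      exact ENNReal.mul_lt_top (ENNReal.mul_lt_top hf.2 hk.2) measure_Icc_lt_top

end Pairing

/-! ### The tail measure -/

theorem measurable_tailDensity (b : ℝ) : Measurable fun x : Sp N => 1 / (1 + ‖x‖ ^ b) := by
  fun_prop

theorem integrable_tailDensity {α : ℝ} (hα : 0 < α) :
    Integrable fun x : Sp N => 1 / (1 + ‖x‖ ^ ((N : ℝ) + α)) := by
  have hb : 0 < (N : ℝ) + α := by positivity
  have h := (integrable_one_add_norm (E := Sp N) (μ := volume) (r := (N : ℝ) + α)
    (by simpa using hα)).const_mul (2 ^ ((N : ℝ) + α))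
  refine h.mono' (measurable_tailDensity _).aestronglyMeasurable (Eventually.of_forall fun x => ?_)
  have hx := norm_nonneg x
  rw [Real.norm_of_nonneg (by positivity), Real.rpow_neg (by positivity), ← div_eq_mul_inv,
    div_le_div_iff₀ (by positivity) (by positivity), one_mul]
  rcases le_total ‖x‖ 1 with h1 | h1
  · calc (1 + ‖x‖) ^ ((N : ℝ) + α) ≤ 2 ^ ((N : ℝ) + α) := by gcongr; linarith
      _ ≤ _ := le_mul_of_one_le_right (by positivity) (by linarith [Real.rpow_nonneg hx (N + α)])
  · calc (1 + ‖x‖) ^ ((N : ℝ) + α) ≤ (2 * ‖x‖) ^ ((N : ℝ) + α) := by gcongr; linarith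
      _ = 2 ^ ((N : ℝ) + α) * ‖x‖ ^ ((N : ℝ) + α) := Real.mul_rpow (by norm_num) hx
      _ ≤ _ := by gcongr; linarith

theorem isFiniteMeasure_tailMeasure {α : ℝ} (hα : 0 < α) : IsFiniteMeasure (tailMeasure N α) :=
  isFiniteMeasure_withDensity_ofReal (integrable_tailDensity hα).2

theorem tailMeasure_ac (α : ℝ) : tailMeasure N α ≪ volume := withDensity_absolutelyContinuous _ _

theorem ac_tailMeasure (α : ℝ) : (volume : Measure (Sp N)) ≪ tailMeasure N α := by
  refine withDensity_absolutelyContinuous' (measurable_tailDensity _).ennreal_ofReal.aemeasurable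
    (Eventually.of_forall fun x => ?_)
  have : 0 < 1 / (1 + ‖x‖ ^ ((N : ℝ) + α)) := by positivity
  simpa using this

/-! ### Truncation in `X^{s,p}_0` -/

theorem MemX.aestronglyMeasurable {s p : ℝ} {Ω Ω' : Set (Sp N)} {ψ v : Sp N → ℝ}
    (hv : MemX s p Ω Ω' ψ v) : AEStronglyMeasurable v volume :=
  hv.2.1.1.mono_ac (ac_tailMeasure _)

theorem aestronglyMeasurable_diffQuot {β q : ℝ} {v : Sp N → ℝ} {μ : Measure (Sp N)} [SFinite μ]
    (hv : AEStronglyMeasurable v μ) : AEStronglyMeasurable (diffQuot β q v) (μ.prod μ) := by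
  have h : Measurable fun z : Sp N × Sp N => (‖z.1 - z.2‖ ^ (((N : ℝ) + β * q) / q))⁻¹ := by
    fun_prop
  have := ((hv.comp_fst (ν := μ)).sub (hv.comp_snd (μ := μ))).mul h.aestronglyMeasurable
  exact this.congr (Eventually.of_forall fun z => by simp [diffQuot, div_eq_mul_inv])

theorem abs_diffQuot_trunc_le (β q M : ℝ) (v : Sp N → ℝ) (z : Sp N × Sp N) :
    |diffQuot β q (fun x => trunc M (v x)) z| ≤ |diffQuot β q v z| := by
  unfold diffQuot
  rw [abs_div, abs_div]
  exact div_le_div_of_nonneg_right (abs_trunc_sub_le M _ _) (abs_nonneg _)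

/-- A 1-Lipschitz map does not increase difference quotients, and a bounded function is in both
Lebesgue spaces because `Ω'` and the tail measure have finite mass. The exterior value is zero
because `ψ ≤ M` there. -/
theorem MemX.trunc {s p M : ℝ} (hs : 0 < s) (hp : 2 ≤ p) {Ω Ω' : Set (Sp N)}
    (hΩ' : volume Ω' ≠ ∞) {ψ v : Sp N → ℝ} (hv : MemX s p Ω Ω' ψ v)
    (hψ : ∀ᵐ x ∂volume.restrict Ωᶜ, ψ x ≤ M) :
    MemX s p Ω Ω' 0 (fun x => trunc M (v x)) := by
  have hm : AEStronglyMeasurable (fun x => FracParabolic.trunc M (v x)) volume :=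
    (continuous_trunc M).comp_aestronglyMeasurable hv.aestronglyMeasurable
  have hb : ∀ x, ‖FracParabolic.trunc M (v x)‖ ≤ 1 := fun x => abs_trunc_le_one M (v x)
  have : IsFiniteMeasure (volume.restrict Ω') := ⟨by simpa using hΩ'.lt_top⟩
  have : IsFiniteMeasure (tailMeasure N (s * p)) :=
    isFiniteMeasure_tailMeasure (mul_pos hs (by linarith))
  refine ⟨⟨MemLp.of_bound hm.restrict 1 (Eventually.of_forall hb), ?_⟩,
    MemLp.of_bound (hm.mono_ac (tailMeasure_ac _)) 1 (Eventually.of_forall hb), ?_⟩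
  · exact hv.1.2.mono (aestronglyMeasurable_diffQuot hm.restrict)
      (Eventually.of_forall fun z => abs_diffQuot_trunc_le s p M v z)
  · filter_upwards [hv.2.2, hψ] with x h1 h2
    rw [h1, trunc_eq_zero h2, Pi.zero_apply]

/-! ### Testing with functions that do not depend on time -/

theorem isTestFunction_const {s p : ℝ} (hp : 2 ≤ p) {Ω Ω' : Set (Sp N)} {v : Sp N → ℝ}
    (hv : MemX s p Ω Ω' 0 v) (hv2 : MemLp v 2 (volume.restrict Ω)) (T₀ T₁ : ℝ) :
    IsTestFunction s p Ω Ω' T₀ T₁ (fun _ => v) (fun _ => hv2.toLp v) where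
  memSobolev := by
    refine ⟨?_, Eventually.of_forall fun _ => hv.1, ?_⟩
    · exact hv.aestronglyMeasurable.comp_snd (μ := volume.restrict (Icc T₀ T₁))
    · rw [setLIntegral_const]
      exact ENNReal.mul_lt_top (ENNReal.rpow_lt_top_of_nonneg (by linarith)
        (ENNReal.add_ne_top.2 ⟨hv.1.1.2.ne, hv.1.2.2.ne⟩)) measure_Icc_lt_top
  memX := Eventually.of_forall fun _ => hv
  curve := fun _ _ => hv2.coeFn_toLp
  contDiff := contDiffOn_const

/-- The integrand of the form associated with `(-Δ_p)^s`. -/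
def formIntegrand (s p : ℝ) (v w : Sp N → ℝ) (z : Sp N × Sp N) : ℝ :=
  Jfun p (v z.1 - v z.2) * (w z.1 - w z.2) / ‖z.1 - z.2‖ ^ ((N : ℝ) + s * p)

section Solution

variable {s p M : ℝ} {Ω Ω' : Set (Sp N)} {t₀ t₁ : ℝ} {g u : ℝ → Sp N → ℝ} {u₀ : Sp N → ℝ}

theorem IsWeakSolution.weak_const (hu : IsWeakSolution s p Ω Ω' t₀ t₁ g u₀ u) (hp : 2 ≤ p)
    {T₀ T₁ : ℝ} (h0 : t₀ ≤ T₀) (h01 : T₀ < T₁) (h1 : T₁ ≤ t₁) {v : Sp N → ℝ}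
    (hv : MemX s p Ω Ω' 0 v) (hv2 : MemLp v 2 (volume.restrict Ω)) :
    ∫ t in Icc T₀ T₁, ∫ z, formIntegrand s p (u t) v z
      = (∫ x in Ω, u T₀ x * v x) - ∫ x in Ω, u T₁ x * v x := by
  have h := hu.weak T₀ T₁ h0 h01 h1 _ _ (isTestFunction_const hp hv hv2 T₀ T₁)
  have hz : ∀ t, ∫ x in Ω, u t x *
      derivWithin (fun _ : ℝ => hv2.toLp v) (Icc T₀ T₁) t x = 0 := by
    intro t
    rw [derivWithin_fun_const]
    refine integral_eq_zero_of_ae ?_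
    filter_upwards [Lp.coeFn_zero ℝ 2 (volume.restrict Ω)] with x hx
    exact mul_eq_zero_of_right (u t x) hx
  simp only [hz, integral_zero, neg_zero, zero_add] at h
  exact h

/-! ### The truncated energy: one-step inequality, continuity and initial value -/

theorem IsWeakSolution.memLp_two (hu : IsWeakSolution s p Ω Ω' t₀ t₁ g u₀ u) {t : ℝ}
    (ht : t ∈ Icc t₀ t₁) : MemLp (u t) 2 (volume.restrict Ω) := by
  obtain ⟨U, hU, -⟩ := hu.continuous
  exact (memLp_congr_ae (hU t ht)).1 (Lp.memLp (U t))

/-- The energy `∫_Ω Γ(u(x, t)) dx`, where `Γ` is the convex primitive of the truncation. -/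
def truncEnergy (M : ℝ) (Ω : Set (Sp N)) (u : ℝ → Sp N → ℝ) (t : ℝ) : ℝ :=
  ∫ x in Ω, truncPrim M (u t x)

theorem integrable_truncPrim [IsFiniteMeasure (volume.restrict Ω)] {v : Sp N → ℝ}
    (hv : MemLp v 2 (volume.restrict Ω)) :
    Integrable (fun x => truncPrim M (v x)) (volume.restrict Ω) := by
  have h1 : Integrable (fun x => v x - M) (volume.restrict Ω) :=
    (hv.integrable one_le_two).sub (integrable_const M)
  exact h1.mono ((continuous_truncPrim M).comp_aestronglyMeasurable hv.1)
    (Eventually.of_forall fun x => abs_truncPrim_le M (v x))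

/-- The test function is frozen at the final time `T₁`, the end at which the tangent line inequality
`truncPrim_sub_le` has the required sign. -/
theorem IsWeakSolution.truncEnergy_sub_le [IsFiniteMeasure (volume.restrict Ω)]
    (hu : IsWeakSolution s p Ω Ω' t₀ t₁ g u₀ u) (hp : 2 ≤ p)
    {T₀ T₁ : ℝ} (h0 : t₀ ≤ T₀) (h01 : T₀ < T₁) (h1 : T₁ ≤ t₁)
    (hv : MemX s p Ω Ω' 0 (fun x => trunc M (u T₁ x))) :
    truncEnergy M Ω u T₁ - truncEnergy M Ω u T₀
      ≤ -∫ t in Icc T₀ T₁, ∫ z, formIntegrand s p (u t) (fun x => trunc M (u T₁ x)) z := by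
  have hu0 := hu.memLp_two (t := T₀) ⟨h0, h01.le.trans h1⟩
  have hu1 := hu.memLp_two (t := T₁) ⟨h0.trans h01.le, h1⟩
  have hw : MemLp (fun x => trunc M (u T₁ x)) 2 (volume.restrict Ω) :=
    MemLp.of_bound ((continuous_trunc M).comp_aestronglyMeasurable hu1.1) 1
      (Eventually.of_forall fun x => abs_trunc_le_one M (u T₁ x))
  have i0 : Integrable (fun x => u T₀ x * trunc M (u T₁ x)) (volume.restrict Ω) :=
    hu0.integrable_mul hw
  have i1 : Integrable (fun x => u T₁ x * trunc M (u T₁ x)) (volume.restrict Ω) :=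
    hu1.integrable_mul hw
  rw [hu.weak_const hp h0 h01 h1 hv hw, neg_sub, ← integral_sub i1 i0, truncEnergy, truncEnergy,
    ← integral_sub (integrable_truncPrim hu1) (integrable_truncPrim hu0)]
  refine integral_mono ((integrable_truncPrim hu1).sub (integrable_truncPrim hu0)) (i1.sub i0)
    fun x => ?_
  have := truncPrim_sub_le M (u T₀ x) (u T₁ x)
  dsimp only
  linarith

theorem enorm_integral_truncPrim_sub_le [IsFiniteMeasure (volume.restrict Ω)] {v w : Sp N → ℝ}
    (hv : MemLp v 2 (volume.restrict Ω)) (hw : MemLp w 2 (volume.restrict Ω)) :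
    ‖(∫ x in Ω, truncPrim M (v x)) - ∫ x in Ω, truncPrim M (w x)‖ₑ
      ≤ eLpNorm (v - w) 2 (volume.restrict Ω)
        * (volume.restrict Ω) univ ^ (1 / (1 : ℝ) - 1 / (2 : ℝ)) := by
  rw [← integral_sub (integrable_truncPrim hv) (integrable_truncPrim hw)]
  calc _ ≤ ∫⁻ x in Ω, ‖truncPrim M (v x) - truncPrim M (w x)‖ₑ :=
        enorm_integral_le_lintegral_enorm _
    _ ≤ eLpNorm (v - w) 1 (volume.restrict Ω) := by
        rw [eLpNorm_one_eq_lintegral_enorm]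
        refine lintegral_mono fun x => ?_
        rw [← ofReal_norm, ← ofReal_norm]
        exact ENNReal.ofReal_le_ofReal (abs_truncPrim_sub_le M _ _)
    _ ≤ _ := by
        have := eLpNorm_le_eLpNorm_mul_rpow_measure_univ (μ := volume.restrict Ω) (p := 1) (q := 2)
          one_le_two (hv.1.sub hw.1)
        simpa using this

theorem IsWeakSolution.continuousOn_truncEnergy [IsFiniteMeasure (volume.restrict Ω)]
    (hu : IsWeakSolution s p Ω Ω' t₀ t₁ g u₀ u) :
    ContinuousOn (truncEnergy M Ω u) (Icc t₀ t₁) := by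
  obtain ⟨U, hU, hc⟩ := hu.continuous
  intro t ht
  have h1 := hc t ht
  rw [ContinuousWithinAt, tendsto_iff_edist_tendsto_0] at h1 ⊢
  have hC : (volume.restrict Ω) univ ^ (1 / (1 : ℝ) - 1 / (2 : ℝ)) ≠ ∞ :=
    ENNReal.rpow_ne_top_of_nonneg (by norm_num) (measure_ne_top _ _)
  have h2 := ENNReal.Tendsto.mul_const h1 (Or.inr hC)
  rw [zero_mul] at h2
  refine tendsto_of_tendsto_of_tendsto_of_le_of_le' tendsto_const_nhds h2
    (Eventually.of_forall fun _ => zero_le) ?_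
  filter_upwards [self_mem_nhdsWithin] with r hr
  rw [edist_eq_enorm_sub, Lp.edist_def,
    eLpNorm_congr_ae ((hU r hr).sub (hU t ht))]
  exact enorm_integral_truncPrim_sub_le (hu.memLp_two hr) (hu.memLp_two ht)

/-- The initial condition only concerns `t → t₀`; uniqueness of limits in `L²(Ω)` identifies the
value at `t₀` itself. -/
theorem IsWeakSolution.initial_eq (hu : IsWeakSolution s p Ω Ω' t₀ t₁ g u₀ u) (ht : t₀ < t₁)
    (hu₀ : MemLp u₀ 2 (volume.restrict Ω)) : u t₀ =ᵐ[volume.restrict Ω] u₀ := by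
  obtain ⟨U, hU, hc⟩ := hu.continuous
  have h1 : Tendsto U (𝓝[>] t₀) (𝓝 (U t₀)) :=
    (hc t₀ (left_mem_Icc.2 ht.le)).tendsto.mono_left
      ((nhdsWithin_Ioo_eq_nhdsGT ht).ge.trans (nhdsWithin_mono _ Ioo_subset_Icc_self))
  have h2 : Tendsto U (𝓝[>] t₀) (𝓝 (hu₀.toLp u₀)) := by
    rw [tendsto_iff_edist_tendsto_0]
    refine hu.initial.congr' ?_
    filter_upwards [Ioo_mem_nhdsGT ht] with t h
    rw [Lp.edist_def, eLpNorm_congr_ae ((hU t ⟨h.1.le, h.2.le⟩).sub hu₀.coeFn_toLp)]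
  have h3 := tendsto_nhds_unique h1 h2
  have h4 := hU t₀ (left_mem_Icc.2 ht.le)
  rw [h3] at h4
  exact h4.symm.trans hu₀.coeFn_toLp

theorem IsWeakSolution.truncEnergy_initial (hu : IsWeakSolution s p Ω Ω' t₀ t₁ g u₀ u)
    (ht : t₀ < t₁) (hu₀ : MemLp u₀ 2 (volume.restrict Ω))
    (hu₀M : ∀ᵐ x ∂volume.restrict Ω, u₀ x ≤ M) : truncEnergy M Ω u t₀ = 0 := by
  refine integral_eq_zero_of_ae ?_
  filter_upwards [hu.initial_eq ht hu₀, hu₀M] with x h1 h2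
  rw [h1, truncPrim_eq_zero h2, Pi.zero_apply]

theorem IsWeakSolution.le_of_truncEnergy_le [IsFiniteMeasure (volume.restrict Ω)]
    (hu : IsWeakSolution s p Ω Ω' t₀ t₁ g u₀ u) {t : ℝ} (ht : t ∈ Icc t₀ t₁)
    (h : truncEnergy M Ω u t ≤ 0) : ∀ᵐ x ∂volume.restrict Ω, u t x ≤ M := by
  have h0 : truncEnergy M Ω u t = 0 := h.antisymm (integral_nonneg fun x => truncPrim_nonneg M _)
  rw [truncEnergy, integral_eq_zero_iff_of_nonneg (fun x => truncPrim_nonneg M _)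
    (integrable_truncPrim (hu.memLp_two ht))] at h0
  filter_upwards [h0] with x hx
  by_contra hlt
  exact (truncPrim_pos (not_le.1 hlt)).ne' hx

end Solution

/-! ### Joint integrability -/

theorem memLp_prod_of_lintegral {α β : Type*} [MeasurableSpace α] [MeasurableSpace β]
    {μ : Measure α} {ν : Measure β} [SFinite ν] {q : ℝ} (hq : 0 < q) {f : α × β → ℝ}
    (hf : AEStronglyMeasurable f (μ.prod ν))
    (h : ∫⁻ a, eLpNorm (fun b => f (a, b)) (ENNReal.ofReal q) ν ^ q ∂μ < ∞) :
    MemLp f (ENNReal.ofReal q) (μ.prod ν) := by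
  have hq0 : ENNReal.ofReal q ≠ 0 := by simpa using hq
  refine ⟨hf, ?_⟩
  rw [eLpNorm_lt_top_iff_lintegral_rpow_enorm_lt_top hq0 ENNReal.ofReal_ne_top,
    ENNReal.toReal_ofReal hq.le, lintegral_prod _ (hf.enorm.pow_const q)]
  refine lt_of_eq_of_lt (lintegral_congr fun a => ?_) h
  rw [eLpNorm_eq_lintegral_rpow_enorm_toReal hq0 ENNReal.ofReal_ne_top,
    ENNReal.toReal_ofReal hq.le, ← ENNReal.rpow_mul, one_div_mul_cancel hq.ne', ENNReal.rpow_one]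

section TwoPoint

variable {μ : Measure ℝ}

theorem measurePreserving_prodAssoc_symm :
    MeasurePreserving (fun w : ℝ × (Sp N × Sp N) => ((w.1, w.2.1), w.2.2))
      (μ.prod volume) ((μ.prod volume).prod volume) :=
  (measurePreserving_prodAssoc μ (volume : Measure (Sp N)) (volume : Measure (Sp N))).symm

theorem measurePreserving_swap_snd [SFinite μ] :
    MeasurePreserving (Prod.map id Prod.swap : ℝ × (Sp N × Sp N) → ℝ × (Sp N × Sp N))
      (μ.prod volume) (μ.prod volume) :=
  (MeasurePreserving.id μ).prod Measure.measurePreserving_swap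

theorem aestronglyMeasurable_first {u : ℝ → Sp N → ℝ}
    (hu : AEStronglyMeasurable (Function.uncurry u) (μ.prod volume)) :
    AEStronglyMeasurable (fun w : ℝ × (Sp N × Sp N) => u w.1 w.2.1) (μ.prod volume) :=
  (hu.comp_fst (ν := (volume : Measure (Sp N)))).comp_measurePreserving
    measurePreserving_prodAssoc_symm

theorem aestronglyMeasurable_second [SFinite μ] {u : ℝ → Sp N → ℝ}
    (hu : AEStronglyMeasurable (Function.uncurry u) (μ.prod volume)) :
    AEStronglyMeasurable (fun w : ℝ × (Sp N × Sp N) => u w.1 w.2.2) (μ.prod volume) :=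
  (aestronglyMeasurable_first hu).comp_measurePreserving measurePreserving_swap_snd

theorem integrable_first_mul {h : ℝ × Sp N → ℝ} {m : Sp N → ℝ}
    (hh : Integrable h (μ.prod volume)) (hm : Integrable m) :
    Integrable (fun w : ℝ × (Sp N × Sp N) => h (w.1, w.2.1) * m w.2.2) (μ.prod volume) :=
  measurePreserving_prodAssoc_symm.integrable_comp_of_integrable (hh.mul_prod hm)

theorem integrable_second_mul [SFinite μ] {h : ℝ × Sp N → ℝ} {m : Sp N → ℝ}
    (hh : Integrable h (μ.prod volume)) (hm : Integrable m) :
    Integrable (fun w : ℝ × (Sp N × Sp N) => h (w.1, w.2.2) * m w.2.1) (μ.prod volume) :=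
  measurePreserving_swap_snd.integrable_comp_of_integrable (integrable_first_mul hh hm)

end TwoPoint

/-- Tonelli: with equal exponents in time and space, the mixed norm is a single integral over
space-time. -/
theorem MemLpTail.integrable {q α : ℝ} (hq : 0 < q) {J : Set ℝ} {u : ℝ → Sp N → ℝ}
    (hu : MemLpTail q J q α u) :
    Integrable (fun w : ℝ × Sp N => |u w.1 w.2| ^ q * (1 / (1 + ‖w.2‖ ^ ((N : ℝ) + α))))
      ((volume.restrict J).prod volume) := by
  obtain ⟨hm, hae, hfin⟩ := hu
  have hq0 : ENNReal.ofReal q ≠ 0 := by simpa using hq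
  have hmeas : AEStronglyMeasurable
      (fun w : ℝ × Sp N => |u w.1 w.2| ^ q * (1 / (1 + ‖w.2‖ ^ ((N : ℝ) + α))))
      ((volume.restrict J).prod volume) := by
    refine AEStronglyMeasurable.mul ?_ (by fun_prop : Measurable _).aestronglyMeasurable
    exact (hm.norm.aemeasurable.pow_const q).aestronglyMeasurable
  refine ⟨hmeas, ?_⟩
  rw [HasFiniteIntegral, lintegral_prod _ hmeas.enorm]
  refine lt_of_eq_of_lt (lintegral_congr_ae ?_) hfin
  filter_upwards [hae] with t ht
  have hut : AEStronglyMeasurable (u t) volume := ht.1.mono_ac (ac_tailMeasure _)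
  rw [tailENorm, eLpNorm_eq_lintegral_rpow_enorm_toReal hq0 ENNReal.ofReal_ne_top,
    ENNReal.toReal_ofReal hq.le, ← ENNReal.rpow_mul, one_div_mul_cancel hq.ne', ENNReal.rpow_one,
    tailMeasure, lintegral_withDensity_eq_lintegral_mul₀
      (measurable_tailDensity _).ennreal_ofReal.aemeasurable (hut.enorm.pow_const q)]
  refine lintegral_congr fun x => ?_
  rw [Pi.mul_apply, enorm_mul, mul_comm, ← ofReal_norm (1 / _), Real.norm_of_nonneg (by positivity),
    Real.enorm_rpow_of_nonneg (abs_nonneg _) hq.le, Real.enorm_abs]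

/-! ### The two parts of the form -/

/-- The pairs of points of which one lies in `Ω` and the other one outside `Ω'`. -/
def farPairs (Ω Ω' : Set (Sp N)) : Set (Sp N × Sp N) := Ω ×ˢ Ω'ᶜ ∪ Ω'ᶜ ×ˢ Ω

theorem measurableSet_farPairs {Ω Ω' : Set (Sp N)} (hΩ : IsOpen Ω) (hΩ' : IsOpen Ω') :
    MeasurableSet (farPairs Ω Ω') :=
  (hΩ.measurableSet.prod hΩ'.measurableSet.compl).union
    (hΩ'.measurableSet.compl.prod hΩ.measurableSet)

/-- Far pairs stay at a distance `d > 0`, because the compact set `closure Ω` lies in the open set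
`Ω'`. The singular kernel is then dominated by a product of tail weights, one for each point. -/
theorem exists_kernel_le {Ω Ω' : Set (Sp N)} (hΩ' : IsOpen Ω') (hΩ'b : Bornology.IsBounded Ω')
    (hΩΩ' : closure Ω ⊆ Ω') {b : ℝ} (hb : 0 < b) :
    ∃ C : ℝ, 0 ≤ C ∧ ∀ z ∈ farPairs Ω Ω',
      1 / ‖z.1 - z.2‖ ^ b ≤ C * (1 / (1 + ‖z.1‖ ^ b) * (1 / (1 + ‖z.2‖ ^ b))) := by
  have hK : IsCompact (closure Ω) :=
    Metric.isCompact_of_isClosed_isBounded isClosed_closure (hΩ'b.subset hΩΩ')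
  obtain ⟨d, hd, hdK⟩ := hK.exists_thickening_subset_open hΩ' hΩΩ'
  obtain ⟨R, hR, hRΩ⟩ := (hΩ'b.subset (subset_closure.trans hΩΩ')).exists_pos_norm_le
  have key : ∀ x ∈ Ω, ∀ y ∉ Ω', 1 / ‖x - y‖ ^ b ≤
      ((1 + R ^ b) * (1 / d ^ b + (R / d + 1) ^ b)) *
        (1 / (1 + ‖x‖ ^ b) * (1 / (1 + ‖y‖ ^ b))) := by
    intro x hx y hy
    have hxy : d ≤ ‖x - y‖ := by
      by_contra! h
      refine hy (hdK (Metric.mem_thickening_iff.2 ⟨x, subset_closure hx, ?_⟩))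
      rwa [dist_comm, dist_eq_norm]
    have h0 : 0 < ‖x - y‖ := hd.trans_le hxy
    have hxR : ‖x‖ ^ b ≤ R ^ b := by gcongr; exact hRΩ x hx
    have hy1 : 1 + ‖y‖ ^ b ≤ (1 / d ^ b + (R / d + 1) ^ b) * ‖x - y‖ ^ b := by
      rw [add_mul, ← Real.mul_rpow (by positivity) h0.le]
      refine add_le_add ?_ ?_
      · rw [one_div, inv_mul_eq_div, one_le_div (by positivity)]
        gcongr
      · gcongr
        have h1 : ‖y‖ ≤ ‖x‖ + ‖x - y‖ := by
          have := norm_sub_le x (x - y)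
          rwa [sub_sub_cancel] at this
        have h2 : R ≤ R / d * ‖x - y‖ := by
          rw [div_mul_eq_mul_div, le_div_iff₀ hd]; gcongr
        linarith [hRΩ x hx]
    have h3 : (1 + ‖x‖ ^ b) * (1 + ‖y‖ ^ b)
        ≤ (1 + R ^ b) * ((1 / d ^ b + (R / d + 1) ^ b) * ‖x - y‖ ^ b) := by gcongr
    rw [one_div_mul_one_div, mul_one_div,
      div_le_div_iff₀ (by positivity) (by positivity), one_mul, mul_assoc]
    exact h3
  refine ⟨(1 + R ^ b) * (1 / d ^ b + (R / d + 1) ^ b), by positivity, fun z hz => ?_⟩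
  rcases hz with hz | hz
  · exact key _ hz.1 _ hz.2
  · rw [norm_sub_rev, mul_comm (1 / (1 + ‖z.1‖ ^ b))]
    exact key _ hz.2 _ hz.1

/-- The time dependent difference quotient on `J × Ω' × Ω'`. -/
def nearQuot (s p : ℝ) (J : Set ℝ) (Ω' : Set (Sp N)) (u : ℝ → Sp N → ℝ) : ℝ × (Sp N × Sp N) → ℝ :=
  (J ×ˢ (Ω' ×ˢ Ω')).indicator fun w => diffQuot s p (u w.1) w.2

/-- The integrand `J_p(u(x, t) - u(y, t)) / |x - y|^(N + sp)` for pairs that are far apart. -/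
def farFlux (s p : ℝ) (J : Set ℝ) (Ω Ω' : Set (Sp N)) (u : ℝ → Sp N → ℝ) :
    ℝ × (Sp N × Sp N) → ℝ :=
  (J ×ˢ farPairs Ω Ω').indicator fun w =>
    Jfun p (u w.1 w.2.1 - u w.1 w.2.2) / ‖w.2.1 - w.2.2‖ ^ ((N : ℝ) + s * p)

/-- The differences `u(x, t) - u(y, t)` for `t ∈ J`. -/
def timeDiff (J : Set ℝ) (u : ℝ → Sp N → ℝ) : ℝ × (Sp N × Sp N) → ℝ :=
  (J ×ˢ univ).indicator fun w => u w.1 w.2.1 - u w.1 w.2.2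

theorem aestronglyMeasurable_diff {J : Set ℝ} {u : ℝ → Sp N → ℝ} (hu : JointlyMeasurable J u) :
    AEStronglyMeasurable (fun w : ℝ × (Sp N × Sp N) => u w.1 w.2.1 - u w.1 w.2.2)
      (volume.restrict (J ×ˢ univ)) := by
  rw [Measure.volume_eq_prod, ← Measure.prod_restrict, Measure.restrict_univ]
  exact (aestronglyMeasurable_first hu).sub (aestronglyMeasurable_second hu)

theorem JointlyMeasurable.trunc {J : Set ℝ} {u : ℝ → Sp N → ℝ} (hu : JointlyMeasurable J u)
    (M : ℝ) : JointlyMeasurable J fun t x => trunc M (u t x) :=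
  (continuous_trunc M).comp_aestronglyMeasurable hu

theorem memLp_timeDiff_trunc {J : Set ℝ} (hJ : MeasurableSet J) {u : ℝ → Sp N → ℝ}
    (hu : JointlyMeasurable J u) (M : ℝ) :
    MemLp (timeDiff J fun t x => trunc M (u t x)) ∞ volume := by
  refine (memLp_indicator_iff_restrict (hJ.prod MeasurableSet.univ)).2 ?_
  exact memLp_top_of_bound (aestronglyMeasurable_diff (hu.trunc M)) 1
    (Eventually.of_forall fun w => abs_trunc_sub_le_one M _ _)

theorem aestronglyMeasurable_nearQuot {s p : ℝ} {J : Set ℝ} (hJ : MeasurableSet J)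
    {Ω' : Set (Sp N)} (hΩ' : MeasurableSet Ω') {u : ℝ → Sp N → ℝ} (hu : JointlyMeasurable J u) :
    AEStronglyMeasurable (nearQuot s p J Ω' u) volume := by
  refine (aestronglyMeasurable_indicator_iff (hJ.prod (hΩ'.prod hΩ'))).2 ?_
  have h1 := (aestronglyMeasurable_diff hu).mono_measure
    (Measure.restrict_mono (prod_mono_right (subset_univ (Ω' ×ˢ Ω'))) le_rfl)
  have h2 : Measurable fun w : ℝ × (Sp N × Sp N) =>
      (‖w.2.1 - w.2.2‖ ^ (((N : ℝ) + s * p) / p))⁻¹ := by fun_prop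
  exact (h1.mul h2.aestronglyMeasurable).congr
    (Eventually.of_forall fun w => by simp [diffQuot, div_eq_mul_inv])

theorem MemLpSobolev.memLp_nearQuot {s p : ℝ} (hp : 0 < p) {J : Set ℝ} (hJ : MeasurableSet J)
    {Ω' : Set (Sp N)} (hΩ' : MeasurableSet Ω') {u : ℝ → Sp N → ℝ}
    (hu : MemLpSobolev p J s p Ω' u) :
    MemLp (nearQuot s p J Ω' u) (ENNReal.ofReal p) volume := by
  have hm := aestronglyMeasurable_nearQuot (s := s) (p := p) hJ hΩ' hu.1
  have hs := hJ.prod (hΩ'.prod hΩ')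
  have e : (volume : Measure (ℝ × (Sp N × Sp N))).restrict (J ×ˢ (Ω' ×ˢ Ω'))
      = (volume.restrict J).prod ((volume.restrict Ω').prod (volume.restrict Ω')) := by
    rw [Measure.volume_eq_prod, Measure.volume_eq_prod, Measure.prod_restrict,
      Measure.prod_restrict]
  rw [nearQuot, aestronglyMeasurable_indicator_iff hs] at hm
  refine (memLp_indicator_iff_restrict hs).2 ?_
  rw [e] at hm ⊢
  refine memLp_prod_of_lintegral hp hm ((lintegral_mono fun t => ?_).trans_lt hu.2.2)
  refine ENNReal.rpow_le_rpow ?_ hp.le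
  exact le_add_self

theorem memLp_nearQuot_trunc {s p M : ℝ} {J J' : Set ℝ} (hJ' : MeasurableSet J') (hJJ' : J' ⊆ J)
    {Ω' : Set (Sp N)} (hΩ' : MeasurableSet Ω') {u : ℝ → Sp N → ℝ} {q : ℝ≥0∞}
    (hu : JointlyMeasurable J' u) (h : MemLp (nearQuot s p J Ω' u) q volume) :
    MemLp (nearQuot s p J' Ω' fun t x => trunc M (u t x)) q volume := by
  refine h.mono (aestronglyMeasurable_nearQuot hJ' hΩ' (hu.trunc M))
    (Eventually.of_forall fun w => ?_)
  by_cases hw : w ∈ J' ×ˢ (Ω' ×ˢ Ω')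
  · rw [nearQuot, nearQuot, indicator_of_mem hw, indicator_of_mem (prod_mono_left hJJ' hw)]
    exact abs_diffQuot_trunc_le s p M (u w.1) w.2
  · rw [nearQuot, indicator_of_notMem hw, norm_zero]
    exact norm_nonneg _

theorem memLp_Jfun_comp {α : Type*} [MeasurableSpace α] {μ : Measure α} {p : ℝ} (hp : 2 ≤ p)
    {f : α → ℝ} (hf : MemLp f (ENNReal.ofReal p) μ) :
    MemLp (fun x => Jfun p (f x)) (ENNReal.ofReal (p / (p - 1))) μ := by
  have h := hf.norm_rpow_div (ENNReal.ofReal (p - 1))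
  rw [ENNReal.toReal_ofReal (by linarith), ← ENNReal.ofReal_div_of_pos (by linarith)] at h
  refine h.mono ((measurable_Jfun p).comp_aemeasurable hf.1.aemeasurable).aestronglyMeasurable
    (Eventually.of_forall fun x => ?_)
  rw [Real.norm_eq_abs, abs_Jfun hp, Real.norm_of_nonneg (by positivity), Real.norm_eq_abs]

/-- The flux is at most a multiple of `|u(x)|^(p-1) + |u(y)|^(p-1)` times both tail weights. In each
term one weight makes `|u|^(p-1)` integrable and the other is integrable by itself. -/
theorem MemLpTail.memLp_farFlux {s p : ℝ} (hs : 0 < s) (hp : 2 ≤ p) {J : Set ℝ}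
    (hJ : MeasurableSet J) {Ω Ω' : Set (Sp N)} (hΩ : IsOpen Ω) (hΩ' : IsOpen Ω')
    (hΩ'b : Bornology.IsBounded Ω') (hΩΩ' : closure Ω ⊆ Ω') {u : ℝ → Sp N → ℝ}
    (hu : MemLpTail (p - 1) J (p - 1) (s * p) u) :
    MemLp (farFlux s p J Ω Ω' u) 1 volume := by
  have hsp : 0 < s * p := mul_pos hs (by linarith)
  have hS := measurableSet_farPairs hΩ hΩ'
  obtain ⟨C, hC, hk⟩ := exists_kernel_le hΩ' hΩ'b hΩΩ' (b := (N : ℝ) + s * p) (by positivity)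
  have hm := hu.integrable (by linarith)
  have hd := integrable_tailDensity (N := N) hsp
  have hI := ((integrable_first_mul hm hd).add (integrable_second_mul hm hd)).const_mul
    (2 ^ (p - 1) * C)
  rw [← Measure.restrict_univ (μ := (volume : Measure (Sp N × Sp N))), Measure.prod_restrict,
    ← Measure.volume_eq_prod] at hI
  rw [memLp_one_iff_integrable, farFlux, integrable_indicator_iff (hJ.prod hS)]
  have hsub := Measure.restrict_mono (prod_mono_right (s := J) (subset_univ (farPairs Ω Ω')))
    (le_refl (volume : Measure (ℝ × (Sp N × Sp N))))
  have h1 := (aestronglyMeasurable_diff hu.1).mono_measure hsub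
  refine (hI.mono_measure hsub).mono' ?_ ?_
  · exact (((measurable_Jfun p).comp_aemeasurable h1.aemeasurable).div
      (by fun_prop : Measurable _).aemeasurable).aestronglyMeasurable
  · filter_upwards [ae_restrict_mem (hJ.prod hS)] with w hw
    have h2 := hk w.2 hw.2
    have h3 := abs_Jfun_sub_le hp (u w.1 w.2.1) (u w.1 w.2.2)
    rw [Real.norm_eq_abs, abs_div, abs_of_nonneg (by positivity : 0 ≤ ‖w.2.1 - w.2.2‖ ^ ((N : ℝ) + s * p)),
      div_eq_mul_one_div]
    refine (mul_le_mul h3 h2 (by positivity) (by positivity)).trans (le_of_eq ?_)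
    simp only [Pi.add_apply]
    ring

theorem formIntegrand_nonneg (s p : ℝ) {G : ℝ → ℝ} (hG : Monotone G) (v : Sp N → ℝ)
    (z : Sp N × Sp N) : 0 ≤ formIntegrand s p v (fun x => G (v x)) z :=
  div_nonneg (Jfun_sub_mul_nonneg p hG _ _) (by positivity)

/-! ### Splitting the form into near and far pairs -/

section Decomposition

variable {s p : ℝ} {J J' : Set ℝ} {Ω Ω' : Set (Sp N)} {u v : ℝ → Sp N → ℝ}

theorem near_mul_of_mem (hp : 2 ≤ p) (hs : 0 < s) {t τ : ℝ} (ht : t ∈ J) (hτ : τ ∈ J')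
    {z : Sp N × Sp N} (hz : z ∈ Ω' ×ˢ Ω') :
    Jfun p (nearQuot s p J Ω' u (t, z)) * nearQuot s p J' Ω' v (τ, z)
      = formIntegrand s p (u t) (v τ) z := by
  rw [nearQuot, nearQuot, indicator_of_mem (mk_mem_prod ht hz), indicator_of_mem (mk_mem_prod hτ hz)]
  exact Jfun_diffQuot_mul hp (by have := mul_pos hs (by linarith : 0 < p); positivity) _ _
    (norm_nonneg _)

theorem far_mul_of_mem {t τ : ℝ} (ht : t ∈ J) (hτ : τ ∈ J')
    {z : Sp N × Sp N} (hz : z ∈ farPairs Ω Ω') :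
    farFlux s p J Ω Ω' u (t, z) * timeDiff J' v (τ, z) = formIntegrand s p (u t) (v τ) z := by
  rw [farFlux, timeDiff, indicator_of_mem (mk_mem_prod ht hz),
    indicator_of_mem (mk_mem_prod hτ (mem_univ z)), formIntegrand, div_mul_eq_mul_div]

theorem near_mul_of_notMem {t τ : ℝ} {z : Sp N × Sp N} (h : τ ∉ J' ∨ z ∉ Ω' ×ˢ Ω') :
    Jfun p (nearQuot s p J Ω' u (t, z)) * nearQuot s p J' Ω' v (τ, z) = 0 := by
  rw [nearQuot, nearQuot, indicator_of_notMem (a := (τ, z)), mul_zero]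
  rintro ⟨h1, h2⟩
  exact h.elim (· h1) (· h2)

theorem far_mul_of_notMem {t τ : ℝ} {z : Sp N × Sp N} (h : τ ∉ J' ∨ z ∉ farPairs Ω Ω') :
    farFlux s p J Ω Ω' u (t, z) * timeDiff J' v (τ, z) = 0 := by
  rcases h with h | h
  · rw [timeDiff, indicator_of_notMem (fun hw => h hw.1), mul_zero]
  · rw [farFlux, indicator_of_notMem (fun hw => h hw.2), zero_mul]

theorem notMem_farPairs {z : Sp N × Sp N} (hz : z ∈ Ω' ×ˢ Ω') :
    z ∉ farPairs Ω Ω' := by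
  rintro (h | h)
  · exact h.2 hz.2
  · exact h.1 hz.1

/-- A pair that is neither in `Ω' × Ω'` nor far has both points outside `Ω`, where the test function
vanishes. -/
theorem near_add_far_eq (hp : 2 ≤ p) (hs : 0 < s) (hΩΩ' : Ω ⊆ Ω') {t τ : ℝ} (ht : t ∈ J)
    (hτ : τ ∈ J') {z : Sp N × Sp N} (h1 : z.1 ∉ Ω → v τ z.1 = 0) (h2 : z.2 ∉ Ω → v τ z.2 = 0) :
    Jfun p (nearQuot s p J Ω' u (t, z)) * nearQuot s p J' Ω' v (τ, z)
      + farFlux s p J Ω Ω' u (t, z) * timeDiff J' v (τ, z) = formIntegrand s p (u t) (v τ) z := by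
  by_cases hz : z ∈ Ω' ×ˢ Ω'
  · rw [near_mul_of_mem hp hs ht hτ hz, far_mul_of_notMem (.inr (notMem_farPairs hz)),
      add_zero]
  · rw [near_mul_of_notMem (.inr hz), zero_add]
    by_cases hz' : z ∈ farPairs Ω Ω'
    · exact far_mul_of_mem ht hτ hz'
    · rw [far_mul_of_notMem (.inr hz')]
      have h1' : z.1 ∉ Ω := fun h =>
        hz' (.inl ⟨h, fun h' => hz ⟨hΩΩ' h, h'⟩⟩)
      have h2' : z.2 ∉ Ω := fun h =>
        hz' (.inr ⟨fun h' => hz ⟨h', hΩΩ' h⟩, h⟩)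
      rw [formIntegrand, h1 h1', h2 h2']
      simp

theorem near_add_far_nonneg (hp : 2 ≤ p) (hs : 0 < s) (hJ : J' ⊆ J) {G : ℝ → ℝ}
    (hG : Monotone G) (w : ℝ × (Sp N × Sp N)) :
    0 ≤ Jfun p (nearQuot s p J Ω' u w) * nearQuot s p J' Ω' (fun t x => G (u t x)) w
      + farFlux s p J Ω Ω' u w * timeDiff J' (fun t x => G (u t x)) w := by
  obtain ⟨t, z⟩ := w
  by_cases ht : t ∈ J'
  · by_cases hz : z ∈ Ω' ×ˢ Ω'
    · rw [near_mul_of_mem hp hs (hJ ht) ht hz,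
        far_mul_of_notMem (.inr (notMem_farPairs hz)), add_zero]
      exact formIntegrand_nonneg s p hG _ _
    · rw [near_mul_of_notMem (.inr hz), zero_add]
      by_cases hz' : z ∈ farPairs Ω Ω'
      · rw [far_mul_of_mem (hJ ht) ht hz']
        exact formIntegrand_nonneg s p hG _ _
      · rw [far_mul_of_notMem (.inr hz')]
  · rw [near_mul_of_notMem (.inl ht), far_mul_of_notMem (.inl ht), zero_add]

end Decomposition

/-! ### From shifted differences to monotonicity -/

/-- A substitute for integrating `y' ≤ 0` when `y` is merely continuous: the inequality is divided
by `σ` and `σ` tends to `0`. -/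
theorem le_of_setIntegral_shift_le {y C : ℝ → ℝ} {t₀ t₁ a T c : ℝ}
    (hy : ContinuousOn y (Icc t₀ t₁)) (ha : t₀ < a) (haT : a ≤ T) (hT : T ≤ t₁)
    (hC : Tendsto C (𝓝 0) (𝓝 c)) (hc : 0 ≤ c) (hCi : ∀ σ, IntegrableOn C (Icc 0 σ))
    (h : ∀ σ, 0 < σ → σ < a - t₀ →
      ∫ r in Icc 0 σ, C r ≤ ∫ τ in Icc a T, (y (τ - σ) - y τ)) : y T ≤ y a := by
  refine le_of_forall_pos_le_add fun ε hε => ?_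
  have hint : ∀ b d, t₀ ≤ b → b ≤ t₁ → t₀ ≤ d → d ≤ t₁ → IntervalIntegrable y volume b d :=
    fun b d hb hb' hd hd' => (hy.mono (uIcc_subset_Icc ⟨hb, hb'⟩ ⟨hd, hd'⟩)).intervalIntegrable
  obtain ⟨δ₁, hδ₁, h1⟩ := Metric.continuousWithinAt_iff.1 (hy T ⟨by linarith, hT⟩) (ε / 3)
    (by positivity)
  obtain ⟨δ₂, hδ₂, h2⟩ := Metric.continuousWithinAt_iff.1 (hy a ⟨ha.le, by linarith⟩) (ε / 3)
    (by positivity)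
  obtain ⟨δ₃, hδ₃, h3⟩ := Metric.eventually_nhds_iff.1
    (hC.eventually (lt_mem_nhds (show -(ε / 3) < c by linarith)))
  -- The three radii serve continuity at `T`, at `a` and of `C` at `0`, each costing `ε / 3`; the
  -- bound `a - t₀` keeps `τ - σ` inside the interval.
  obtain ⟨σ, hσ, hσ'⟩ : ∃ σ, 0 < σ ∧ σ < min (min δ₁ δ₂) (min δ₃ (a - t₀)) :=
    exists_between (by simp only [lt_min_iff]; exact ⟨⟨hδ₁, hδ₂⟩, hδ₃, by linarith⟩)
  simp only [lt_min_iff] at hσ'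
  obtain ⟨⟨hσ1, hσ2⟩, hσ3, hσ4⟩ := hσ'
  have hmain := h σ hσ hσ4
  -- The integrals over the common range cancel, leaving one interval of length `σ` at each end.
  have e : ∫ τ in Icc a T, (y (τ - σ) - y τ) = (∫ τ in (a - σ)..a, y τ) - ∫ τ in (T - σ)..T, y τ := by
    rw [integral_Icc_eq_integral_Ioc, ← intervalIntegral.integral_of_le haT,
      intervalIntegral.integral_sub, intervalIntegral.integral_comp_sub_right,
      intervalIntegral.integral_interval_sub_interval_comm]
    · exact hint _ _ (by linarith) (by linarith) (by linarith) (by linarith)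
    · exact hint _ _ (by linarith) (by linarith) (by linarith) (by linarith)
    · exact hint _ _ (by linarith) (by linarith) (by linarith) (by linarith)
    · have := (hint (a - σ) (T - σ) (by linarith) (by linarith) (by linarith)
        (by linarith)).comp_sub_right σ
      simpa using this
    · exact hint _ _ (by linarith) (by linarith) (by linarith) (by linarith)
  have b1 : σ * (y T - ε / 3) ≤ ∫ τ in (T - σ)..T, y τ := by
    have := intervalIntegral.integral_mono_on (a := T - σ) (b := T) (by linarith)
      (intervalIntegrable_const (c := y T - ε / 3))
      (hint (T - σ) T (by linarith) (by linarith) (by linarith) (by linarith)) fun τ hτ => by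
        have := h1 (x := τ) ⟨by linarith [hτ.1], by linarith [hτ.2]⟩
          (by rw [Real.dist_eq, abs_lt]; constructor <;> linarith [hτ.1, hτ.2])
        rw [Real.dist_eq, abs_lt] at this
        linarith [this.1]
    rwa [intervalIntegral.integral_const, smul_eq_mul, sub_sub_cancel] at this
  have b2 : ∫ τ in (a - σ)..a, y τ ≤ σ * (y a + ε / 3) := by
    have := intervalIntegral.integral_mono_on (a := a - σ) (b := a) (by linarith)
      (hint (a - σ) a (by linarith) (by linarith) (by linarith) (by linarith))
      (intervalIntegrable_const (c := y a + ε / 3)) fun τ hτ => by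
        have := h2 (x := τ) ⟨by linarith [hτ.1], by linarith [hτ.2]⟩
          (by rw [Real.dist_eq, abs_lt]; constructor <;> linarith [hτ.1, hτ.2])
        rw [Real.dist_eq, abs_lt] at this
        linarith [this.2]
    rwa [intervalIntegral.integral_const, smul_eq_mul, sub_sub_cancel] at this
  have b3 : σ * (-(ε / 3)) ≤ ∫ r in Icc 0 σ, C r := by
    have := setIntegral_mono_on (integrableOn_const (C := -(ε / 3)) (by simp)) (hCi σ)
      measurableSet_Icc fun r hr => (h3 (y := r) (by
        rw [Real.dist_eq, sub_zero, abs_of_nonneg hr.1]; linarith [hr.2])).le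
    simpa [hσ.le] using this
  rw [e] at hmain
  have : σ * (y T - y a - ε) ≤ 0 := by linarith
  have := nonpos_of_mul_nonpos_right this hσ
  linarith

section Fubini

variable {Z : Type*} [MeasureSpace Z] [SigmaFinite (volume : Measure Z)]

/-- Fubini's theorem for a function on `[0, σ] × (ℝ × Z)` that vanishes outside `[a, T]` in the
second time variable. -/
theorem setIntegral_integral_swap {H : ℝ → ℝ × Z → ℝ} {σ a T : ℝ}
    (hH : Integrable (Function.uncurry H) ((volume.restrict (Icc 0 σ)).prod volume))
    (hr : ∀ r, Integrable (H r))
    (h0 : ∀ r, ∀ τ ∉ Icc a T, ∀ z, H r (τ, z) = 0) :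
    ∫ r in Icc 0 σ, ∫ w, H r w = ∫ τ in Icc a T, ∫ r in Icc 0 σ, ∫ z, H r (τ, z) := by
  have h1 : ∀ r, ∫ w, H r w = ∫ τ, ∫ z, H r (τ, z) := fun r => integral_prod _ (hr r)
  have h2 : Integrable (Function.uncurry fun r τ => ∫ z, H r (τ, z))
      ((volume.restrict (Icc 0 σ)).prod volume) := by
    have := ((measurePreserving_prodAssoc (volume.restrict (Icc 0 σ)) (volume : Measure ℝ)
      (volume : Measure Z)).integrable_comp_of_integrable hH).integral_prod_left
    exact this
  simp_rw [h1]
  rw [integral_integral_swap h2, setIntegral_eq_integral_of_forall_compl_eq_zero]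
  intro τ hτ
  simp [h0 _ τ hτ]

end Fubini

instance : (volume : Measure (Sp N × Sp N)).IsAddHaarMeasure :=
  inferInstanceAs ((volume : Measure (Sp N)).prod (volume : Measure (Sp N))).IsAddHaarMeasure

/-! ### Monotonicity of the truncated energy -/

section Solution

variable {s p M : ℝ} {Ω Ω' : Set (Sp N)} {t₀ t₁ : ℝ} {g u : ℝ → Sp N → ℝ} {u₀ : Sp N → ℝ}

theorem IsWeakSolution.memX_trunc (hu : IsWeakSolution s p Ω Ω' t₀ t₁ g u₀ u) (hs : 0 < s)
    (hp : 2 ≤ p) (hΩ' : volume Ω' ≠ ∞)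
    (hgM : ∀ᵐ z ∂(volume.restrict (Icc t₀ t₁)).prod (volume : Measure (Sp N)), g z.1 z.2 ≤ M) :
    ∀ᵐ t ∂volume.restrict (Icc t₀ t₁), MemX s p Ω Ω' 0 fun x => trunc M (u t x) := by
  filter_upwards [hu.boundary, Measure.ae_ae_of_ae_prod hgM] with t h1 h2
  exact h1.trunc hs hp hΩ' (ae_restrict_of_ae h2)

theorem setIntegral_sub_left (f : ℝ → ℝ) {σ : ℝ} (hσ : 0 ≤ σ) (τ : ℝ) :
    ∫ t in Icc (τ - σ) τ, f t = ∫ r in Icc 0 σ, f (τ - r) := by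
  rw [integral_Icc_eq_integral_Ioc, integral_Icc_eq_integral_Ioc,
    ← intervalIntegral.integral_of_le hσ, ← intervalIntegral.integral_of_le (by linarith),
    intervalIntegral.integral_comp_sub_left, sub_zero]

theorem integral_near_add_far_eq (hp : 2 ≤ p) (hs : 0 < s) (hΩΩ' : Ω ⊆ Ω') (hΩ : IsOpen Ω)
    {J J' : Set ℝ} {v : ℝ → Sp N → ℝ} {t τ : ℝ} (ht : t ∈ J) (hτ : τ ∈ J')
    (hv : v τ =ᵐ[volume.restrict Ωᶜ] 0) :
    ∫ z, (Jfun p (nearQuot s p J Ω' u (t, z)) * nearQuot s p J' Ω' v (τ, z)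
      + farFlux s p J Ω Ω' u (t, z) * timeDiff J' v (τ, z))
      = ∫ z, formIntegrand s p (u t) (v τ) z := by
  have h := (ae_restrict_iff' hΩ.measurableSet.compl).1 hv
  refine integral_congr_ae ?_
  filter_upwards [Measure.quasiMeasurePreserving_fst.ae h, Measure.quasiMeasurePreserving_snd.ae h]
    with z h1 h2
  exact near_add_far_eq hp hs hΩΩ' ht hτ h1 h2

theorem IsWeakSolution.truncEnergy_le (hu : IsWeakSolution s p Ω Ω' t₀ t₁ g u₀ u) (hs : 0 < s)
    (hp : 2 ≤ p) (hΩ : IsOpen Ω) (hΩ' : IsOpen Ω') (hΩ'b : Bornology.IsBounded Ω')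
    (hΩΩ' : closure Ω ⊆ Ω')
    (hgM : ∀ᵐ z ∂(volume.restrict (Icc t₀ t₁)).prod (volume : Measure (Sp N)), g z.1 z.2 ≤ M)
    {a T : ℝ} (ha : t₀ < a) (haT : a ≤ T) (hT : T ≤ t₁) :
    truncEnergy M Ω u T ≤ truncEnergy M Ω u a := by
  have hsub : Ω ⊆ Ω' := subset_closure.trans hΩΩ'
  have : IsFiniteMeasure (volume.restrict Ω) :=
    ⟨by simpa using (hΩ'b.subset hsub).measure_lt_top⟩
  have hJJ : Icc a T ⊆ Icc t₀ t₁ := Icc_subset_Icc ha.le hT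
  have hJm : JointlyMeasurable (Icc a T) u :=
    hu.memSobolev.1.mono_measure (Measure.prod_mono (Measure.restrict_mono hJJ le_rfl) le_rfl)
  have hN := hu.memSobolev.memLp_nearQuot (by linarith) measurableSet_Icc hΩ'.measurableSet
  have hF1 := memLp_Jfun_comp hp hN
  have hK1 := memLp_nearQuot_trunc (M := M) measurableSet_Icc hJJ hΩ'.measurableSet hJm hN
  have hF2 := hu.memTail.memLp_farFlux hs hp measurableSet_Icc hΩ hΩ' hΩ'b hΩΩ'
  have hK2 := memLp_timeDiff_trunc measurableSet_Icc hJm M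
  have hpq : ENNReal.HolderConjugate (ENNReal.ofReal (p / (p - 1))) (ENNReal.ofReal p) :=
    (Real.HolderConjugate.conjExponent (by linarith : 1 < p)).symm.ennrealOfReal
  set F1 := fun w => Jfun p (nearQuot s p (Icc t₀ t₁) Ω' u w)
  set F2 := farFlux s p (Icc t₀ t₁) Ω Ω' u
  set K1 := nearQuot s p (Icc a T) Ω' fun t x => trunc M (u t x)
  set K2 := timeDiff (Icc a T) fun t x => trunc M (u t x)
  -- Only the flux factors are delayed. All factors are extended by zero in time, so that
  -- translations act on the whole line.
  set H : ℝ → ℝ × (Sp N × Sp N) → ℝ :=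
    fun r w => F1 (timeShift r w) * K1 w + F2 (timeShift r w) * K2 w
  have i1 := integrable_timeShift_mul hF1 hK1
  have i2 := integrable_timeShift_mul hF2 hK2
  have hHr : ∀ r, Integrable (H r) := fun r => (i1 r).add (i2 r)
  have hHi : ∀ σ, Integrable (Function.uncurry H) ((volume.restrict (Icc 0 σ)).prod volume) :=
    fun σ => (integrable_timeShift_mul_prod hF1 hK1 σ).add
      (integrable_timeShift_mul_prod hF2 hK2 σ)
  have hlim : Tendsto (fun r => ∫ w, H r w) (𝓝 0) (𝓝 (∫ w, (F1 w * K1 w + F2 w * K2 w))) := by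
    have j1 : Integrable (fun w => F1 w * K1 w) := hF1.integrable_mul hK1
    have j2 : Integrable (fun w => F2 w * K2 w) := hF2.integrable_mul hK2
    rw [integral_add j1 j2]
    refine ((tendsto_integral_timeShift_mul ENNReal.ofReal_ne_top hF1 hK1).add
      (tendsto_integral_timeShift_mul ENNReal.one_ne_top hF2 hK2)).congr fun r => ?_
    exact (integral_add (i1 r) (i2 r)).symm
  refine le_of_setIntegral_shift_le hu.continuousOn_truncEnergy ha haT hT hlim
    (integral_nonneg fun w => near_add_far_nonneg hp hs hJJ (trunc_mono M) w)
    (fun σ => (hHi σ).integral_prod_left) fun σ hσ hσ' => ?_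
  rw [setIntegral_integral_swap (a := a) (T := T) (hHi σ) hHr fun r τ hτ z => by
    have e1 := near_mul_of_notMem (s := s) (p := p) (J := Icc t₀ t₁) (Ω' := Ω') (u := u)
      (v := fun t x => trunc M (u t x)) (t := τ - r) (z := z) (Or.inl hτ)
    have e2 := far_mul_of_notMem (s := s) (p := p) (J := Icc t₀ t₁) (Ω := Ω) (Ω' := Ω') (u := u)
      (v := fun t x => trunc M (u t x)) (t := τ - r) (z := z) (Or.inl hτ)
    exact (congrArg₂ (· + ·) e1 e2).trans (add_zero 0)]
  have hy := hu.continuousOn_truncEnergy (M := M)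
  have hy1 : IntegrableOn (truncEnergy M Ω u) (Icc a T) := (hy.mono hJJ).integrableOn_Icc
  have hy2 : IntegrableOn (fun τ => truncEnergy M Ω u (τ - σ)) (Icc a T) := by
    refine ContinuousOn.integrableOn_Icc (hy.comp (by fun_prop) fun τ hτ => ?_)
    exact ⟨by linarith [hτ.1], by linarith [hτ.2]⟩
  have hHs : Integrable (fun τ => ∫ r in Icc 0 σ, ∫ z, H r (τ, z)) := by
    have := ((measurePreserving_prodAssoc (volume.restrict (Icc 0 σ)) (volume : Measure ℝ)
      (volume : Measure (Sp N × Sp N))).integrable_comp_of_integrable (hHi σ)).integral_prod_left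
    exact this.integral_prod_right
  refine integral_mono_ae hHs.integrableOn (hy2.sub hy1) ?_
  have hX := hu.memX_trunc hs hp hΩ'b.measure_lt_top.ne hgM
  filter_upwards [ae_restrict_of_ae_restrict_of_subset hJJ hX, ae_restrict_mem measurableSet_Icc]
    with τ hτX hτ
  -- The condition `σ < a - t₀` places `[τ - σ, τ]` in the time interval of the equation.
  have hmain := hu.truncEnergy_sub_le hp (T₀ := τ - σ) (T₁ := τ) (by linarith [hτ.1])
    (by linarith) (hτ.2.trans hT) hτX
  rw [setIntegral_sub_left _ hσ.le] at hmain
  have e : ∫ r in Icc 0 σ, ∫ z, H r (τ, z) = ∫ r in Icc 0 σ, ∫ z,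
      formIntegrand s p (u (τ - r)) (fun x => trunc M (u τ x)) z := by
    refine setIntegral_congr_fun measurableSet_Icc fun r hr => ?_
    have ht : τ - r ∈ Icc t₀ t₁ := ⟨by linarith [hτ.1, hr.2], by linarith [hτ.2, hr.1]⟩
    exact integral_near_add_far_eq (J := Icc t₀ t₁) (J' := Icc a T) (t := τ - r) (τ := τ) (u := u)
      (v := fun t x => trunc M (u t x)) hp hs hsub hΩ ht hτ hτX.2.2
  rw [e]
  linarith

theorem IsWeakSolution.truncEnergy_nonpos (hu : IsWeakSolution s p Ω Ω' t₀ t₁ g u₀ u) (hs : 0 < s)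
    (hp : 2 ≤ p) (hΩ : IsOpen Ω) (hΩ' : IsOpen Ω') (hΩ'b : Bornology.IsBounded Ω')
    (hΩΩ' : closure Ω ⊆ Ω') (ht : t₀ < t₁) (hu₀ : MemLp u₀ 2 (volume.restrict Ω))
    (hu₀M : ∀ᵐ x ∂volume.restrict Ω, u₀ x ≤ M)
    (hgM : ∀ᵐ z ∂(volume.restrict (Icc t₀ t₁)).prod (volume : Measure (Sp N)), g z.1 z.2 ≤ M)
    {t : ℝ} (htI : t ∈ Icc t₀ t₁) : truncEnergy M Ω u t ≤ 0 := by
  have : IsFiniteMeasure (volume.restrict Ω) :=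
    ⟨by simpa using (hΩ'b.subset (subset_closure.trans hΩΩ')).measure_lt_top⟩
  have h0 := hu.truncEnergy_initial ht hu₀ hu₀M
  rcases htI.1.eq_or_lt with rfl | hlt
  · exact h0.le
  · rw [← h0]
    have hc := hu.continuousOn_truncEnergy (M := M) t₀ (left_mem_Icc.2 ht.le)
    have hc' : Tendsto (truncEnergy M Ω u) (𝓝[>] t₀) (𝓝 (truncEnergy M Ω u t₀)) :=
      hc.tendsto.mono_left
        ((nhdsWithin_Ioo_eq_nhdsGT ht).ge.trans (nhdsWithin_mono _ Ioo_subset_Icc_self))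
    -- The backward step needs room before `a`, so monotonicity is known only from times `a > t₀`;
    -- continuity of the energy reaches `t₀`.
    refine ge_of_tendsto hc' ?_
    filter_upwards [Ioo_mem_nhdsGT hlt] with a ha
    exact hu.truncEnergy_le hs hp hΩ hΩ' hΩ'b hΩΩ' hgM ha.1 ha.2.le htI.2

end Solution

/-- Joint measurability lets Tonelli be applied to the positive part of `f - M`. -/
theorem ae_prod_le_of_ae_ae_le {α β : Type*} [MeasurableSpace α] [MeasurableSpace β]
    {μ : Measure α} {ν : Measure β} [SFinite ν] {f : α × β → ℝ}
    (hf : AEStronglyMeasurable f (μ.prod ν)) {M : ℝ} (h : ∀ᵐ a ∂μ, ∀ᵐ b ∂ν, f (a, b) ≤ M) :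
    ∀ᵐ z ∂μ.prod ν, f z ≤ M := by
  have hm : AEMeasurable (fun z => ENNReal.ofReal (f z - M)) (μ.prod ν) :=
    (hf.aemeasurable.sub_const M).ennreal_ofReal
  have h0 : ∫⁻ z, ENNReal.ofReal (f z - M) ∂μ.prod ν = 0 := by
    rw [lintegral_prod _ hm]
    refine lintegral_eq_zero_of_ae_eq_zero ?_
    filter_upwards [h] with a ha
    refine lintegral_eq_zero_of_ae_eq_zero ?_
    filter_upwards [ha] with b hb
    simpa using hb
  filter_upwards [(lintegral_eq_zero_iff' hm).1 h0] with z hz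
  simpa using hz

end FracParabolic

end

theorem propositionA3 (N : ℕ) (s p : ℝ) (hs₀ : 0 < s) (hs₁ : s < 1) (hp : 2 ≤ p)
    (Ω Ω' : Set (FracParabolic.Sp N)) (hΩ : IsOpen Ω) (hΩ' : IsOpen Ω')
    (hΩ'b : Bornology.IsBounded Ω') (hΩΩ' : closure Ω ⊆ Ω')
    (t₀ t₁ : ℝ) (ht : t₀ < t₁)
    (g : ℝ → FracParabolic.Sp N → ℝ)
    (hg : FracParabolic.IsBoundaryDatum s p hp Ω Ω' t₀ t₁ g)
    (u₀ : FracParabolic.Sp N → ℝ) (hu₀ : MemLp u₀ 2 (volume.restrict Ω))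
    (u : ℝ → FracParabolic.Sp N → ℝ)
    (hu : FracParabolic.IsWeakSolution s p Ω Ω' t₀ t₁ g u₀ u)
    (M : ℝ) (hu₀M : ∀ᵐ x ∂volume.restrict Ω, u₀ x ≤ M)
    (hgM : ∀ᵐ z ∂(volume.restrict (Icc t₀ t₁)).prod (volume : Measure (FracParabolic.Sp N)),
      g z.1 z.2 ≤ M) :
    (∀ᵐ z ∂(volume.restrict (Icc t₀ t₁)).prod (volume : Measure (FracParabolic.Sp N)),
      u z.1 z.2 ≤ M) ∧
    ∀ t ∈ Icc t₀ t₁, ∀ᵐ x ∂volume.restrict Ω, u t x ≤ M := by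
  have hfin : IsFiniteMeasure (volume.restrict Ω) :=
    ⟨by simpa using (hΩ'b.subset (subset_closure.trans hΩΩ')).measure_lt_top⟩
  have hle : ∀ t ∈ Icc t₀ t₁, ∀ᵐ x ∂volume.restrict Ω, u t x ≤ M := fun t h =>
    hu.le_of_truncEnergy_le h
      (hu.truncEnergy_nonpos hs₀ hp hΩ hΩ' hΩ'b hΩΩ' ht hu₀ hu₀M hgM h)
  refine ⟨FracParabolic.ae_prod_le_of_ae_ae_le hu.memSobolev.1 ?_, hle⟩
  filter_upwards [hu.boundary, Measure.ae_ae_of_ae_prod hgM, ae_restrict_mem measurableSet_Icc]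
    with t h1 h2 h3
  -- The energy argument covers `Ω`; on the complement `u(t) = g(t) ≤ M`.
  refine ae_of_ae_restrict_of_ae_restrict_compl Ω (hle t h3) ?_
  filter_upwards [h1.2.2, ae_restrict_of_ae h2] with x h4 h5
  exact h4.trans_le h5
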